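/- Let $n,p\ge 1$, let $\lambda>0$ be fixed, and write $[m]=\{1,\dots,m\}$. Let $Y$ be a random $n\times p$ real matrix such that $\mathrm{vec}(Y)\in\mathbb R^{np}$ (the columns $Y_{\cdot 1},\dots,Y_{\cdot p}$ stacked one above the other) is Gaussian with mean vector $\beta$ and invertible covariance matrix $\Gamma$. **Right limits and clusterings.** For $K\in[n]$ let $\mathcal T_{K,n}=\{(t_k)_{0\le k\le K}: 0=t_0<t_1<\dots<t_K=n\}$. For $\mathbf t\in\mathcal T_{K,n}$ and a permutation $\sigma$ of $[n]$ put $n_k=t_k-t_{k-1}$, and let $\mathcal C(\mathbf t,\sigma)=(\mathcal C_1,\dots,\mathcal C_K)$ with $\mathcal C_k=\{\sigma(t_{k-1}+1),\dots,\sigma(t_k)\}$. The clustering associated to $B\in\mathbb R^n$ is $(\{i:B_i=b_k\})_{k\in[K]}$, where $b_1>\dots>b_K$ are the sorted distinct values of $B$. **Random clusterings and orders.** For $j\in[p]$, let $$\widehat B_{\cdot j}\in\operatorname*{argmin}_{B\in\mathbb R^n}\ \tfrac12\|B-Y_{\cdot j}\|_2^2+\lambda\sum_{i<i'}|B_{i'}-B_i|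 ,$$ let $S^{(j)}$ be a random permutation of $[n]$ with $Y_{S^{(j)}(1)j}\ge\dots\ge Y_{S^{(j)}(n)j}$ (unique with probability one), and let $\mathbf T^{(j)}\in\mathcal T_{K^{(j)},n}$ (with random $K^{(j)}$) be such that $\mathcal C(\mathbf T^{(j)},S^{(j)})$ is the clustering associated to $\widehat B_{\cdot j}$. **The $p$-value.** For $\mathbf t\in\mathcal T_{K,n}$ let $\mathbf M(\mathbf t)\in\mathbb R^{2(n-1)\times n}$ and $\mathbf m(\mathbf t)\in\mathbb R^{2(n-1)}$ be such that the inequalities $\mathbf M(\mathbf t)u\le\lambda\,\mathbf m(\mathbf t)$ are, for $u\in\mathbb R^n$, $$u_{i+1}-u_i\le 0\ \ (1\le i\le n-1),\qquad \bar u_{k+1}-\bar u_k\le-\lambda(t_{k+1}-t_{k-1})\ \ (1\le k\le K-1),$$ $$\frac1\ell\sum_{i=1}^{\ell}u_{t_{k-1}+i}-\bar u_k\le\lambda(n_k-\ell)\ \ (1\le k\le K,\ 1\le\ell\le n_k-1),\qquad\text{where }\bar u_k=\frac1{n_k}\sum_{i=1}^{n_k}u_{t_{k-1}+i}.$$ For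 a tuple $e=(\mathbf t^{(j)},\sigma^{(j)})_{j\in[p]}$ and a nonzero $\kappa\in\mathbb R^{np}$, let $\mathcal M$ be block diagonal with blocks $\mathbf M(\mathbf t^{(j)})$, let $\mathbf D_\sigma$ be block diagonal with blocks the permutation matrices $\mathbf P_{\sigma^{(j)}}$ (where $\mathbf P_\sigma x=(x_{\sigma(1)},\dots,x_{\sigma(n)})^\top$), let $b$ be the stacked vector of the $\lambda\,\mathbf m(\mathbf t^{(j)})$, and put $A=\mathcal M\mathbf D_\sigma$. With $c=\Gamma\kappa(\kappa^\top\Gamma\kappa)^{-1}$ and, for an $n\times p$ matrix $y$, $z=(I_{np}-c\kappa^\top)\mathrm{vec}(y)$, let $$\mathcal V^-=\max_{l:(Ac)_l<0}\frac{b_l-(Az)_l}{(Ac)_l},\qquad \mathcal V^+=\min_{l:(Ac)_l>0}\frac{b_l-(Az)_l}{(Ac)_l}$$ ($\max\emptyset=-\infty$, $\min\emptyset=+\infty$), let $T(y)=F^{[\mathcal V^-,\mathcal V^+]}_{0,\kappa^\top\Gamma\kappa}(\kappa^\top\mathrm{vec}(y))$, where $F^{[a,b]}_{\nu,\tau^2}$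 is the distribution function of $\mathcal N(\nu,\tau^2)$ truncated to $[a,b]$, and let $\mathrm{pval}(y)=2\min(T(y),1-T(y))$. **Statement.** Let $\mathcal E$ be a subset of the set of all tuples $(\mathbf t^{(j)},\sigma^{(j)})_{j\in[p]}$ (with $\mathbf t^{(j)}\in\mathcal T_{K^{(j)},n}$, $K^{(j)}\in[n]$, and $\sigma^{(j)}$ a permutation of $[n]$), and let $\kappa:\mathcal E\to\mathbb R^{np}\setminus\{0\}$ be a deterministic function (for instance one that depends on the tuple only through a multi-dimensional clustering obtained by aggregating the $p$ one-dimensional clusterings). Assume that the event $$\Big\{(\mathbf T^{(j)},S^{(j)})_{j\in[p]}\in\mathcal E,\ \ \kappa\big((\mathbf T^{(j)},S^{(j)})_{j\in[p]}\big)^\top\beta=0\Big\}$$ has positive probability. Then, conditionally on this event, $\mathrm{pval}(Y)$, computed with the tuple $(\mathbf T^{(j)},S^{(j)})_{j\in[p]}$ and the vector $\kappa\big((\mathbf T^{(j)},S^{(j)})_{j\in[p]}\big)$, is uniformly distributed on $[0,1]$. -/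

import Mathlib

open MeasureTheory ProbabilityTheory Matrix

namespace ConvClust

/-- The objective of the one-dimensional convex clustering problem with penalty level `lam`:
`B ↦ (1/2) ‖B - x‖₂² + lam * ∑_{i < i'} |B i' - B i|`. -/
noncomputable def objective {n : ℕ} (lam : ℝ) (x B : Fin n → ℝ) : ℝ :=
  (1 / 2) * ∑ i, (B i - x i) ^ 2 +
    lam * ∑ i, ∑ i' ∈ Finset.univ.filter (fun i' => i < i'), |B i' - B i|

/-- `B` is in the argmin of the convex clustering problem for the observations `x`. -/
def IsSolution {n : ℕ} (lam : ℝ) (x B : Fin n → ℝ) : Prop :=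
  ∀ B' : Fin n → ℝ, objective lam x B ≤ objective lam x B'

/-- `C = (C_k)_k` is the clustering associated to the vector `B`: with `b_1 > b_2 > ... > b_K` the
sorted distinct values of `B`, the `k`-th cluster is `{i : B i = b_k}`. -/
def IsClusteringOf {n K : ℕ} (B : Fin n → ℝ) (C : Fin K → Set (Fin n)) : Prop :=
  ∃ b : Fin K → ℝ, StrictAnti b ∧ Set.range b = Set.range B ∧ ∀ k, C k = {i | B i = b k}

/-- Right-limit sequences `0 = t_0 < t_1 < ... < t_K = n`, for all numbers of clusters `K` at once
(for `n ≥ 1` the constraints force `1 ≤ K ≤ n`). -/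
structure RightLimits (n : ℕ) where
  K : ℕ
  t : Fin (K + 1) → ℕ
  zero : t 0 = 0
  strictMono : StrictMono t
  last : t (Fin.last K) = n

namespace RightLimits

variable {n : ℕ} (t : RightLimits n)

/-- Cardinality `n_k = t_k - t_{k-1}` of the `k`-th cluster; clusters are numbered from `0`, so
that cluster `k : Fin K` occupies the positions `t_k, ..., t_{k+1} - 1`. -/
def size (k : Fin t.K) : ℕ := t.t k.succ - t.t k.castSucc

/-- The position `i` (numbered from `0`) belongs to the `k`-th segment. -/
def InSeg (k : Fin t.K) (i : Fin n) : Prop := t.t k.castSucc ≤ i ∧ (i : ℕ) < t.t k.succ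

instance (k : Fin t.K) (i : Fin n) : Decidable (t.InSeg k i) :=
  inferInstanceAs (Decidable (_ ∧ _))

/-- The clustering associated to `(t, σ)`: the `k`-th cluster is the image by `σ` of the `k`-th
segment of positions. -/
def cluster (σ : Equiv.Perm (Fin n)) (k : Fin t.K) : Set (Fin n) := σ '' {i | t.InSeg k i}

/-- Index of the left one of two consecutive clusters. -/
def left (k : Fin (t.K - 1)) : Fin t.K := ⟨k, by omega⟩

/-- Index of the right one of two consecutive clusters. -/
def right (k : Fin (t.K - 1)) : Fin t.K := ⟨k + 1, by omega⟩

/-- Index set of the `(n - 1) + (K - 1) + (n - K) = 2 (n - 1)` linear constraints: order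
constraints, constraints separating consecutive clusters, constraints inside the clusters. -/
abbrev Row : Type := Fin (n - 1) ⊕ Fin (t.K - 1) ⊕ (Σ k : Fin t.K, Fin (t.size k - 1))

/-- The matrix `M(t)`, by stacking
* `M₁ u = (u_{i+1} - u_i)_i`,
* `M₂ u = (mean of u over segment k+1 - mean of u over segment k)_k`,
* `M₃ u = (mean of u over the first ℓ positions of segment k - mean of u over segment k)_{k,ℓ}`
  for `1 ≤ ℓ ≤ n_k - 1` (`ℓ` is stored as `ℓ - 1`). -/
noncomputable def M : Matrix t.Row (Fin n) ℝ
  | .inl r, i => if (i : ℕ) = r then -1 else if (i : ℕ) = r + 1 then 1 else 0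
  | .inr (.inl k), i =>
      if t.InSeg (t.left k) i then -(1 / (t.size (t.left k) : ℝ))
      else if t.InSeg (t.right k) i then 1 / (t.size (t.right k) : ℝ) else 0
  | .inr (.inr ⟨k, l⟩), i =>
      if t.InSeg k i then
        (if (i : ℕ) < t.t k.castSucc + (l + 1) then 1 / ((l : ℝ) + 1) else 0) -
          1 / (t.size k : ℝ)
      else 0

/-- The vector `m(t)`, by stacking `m₁ = 0`, `m₂ = (-(t_{k+1} - t_{k-1}))_k` and
`m₃ = (n_k - ℓ)_{k,ℓ}`. -/
noncomputable def m : t.Row → ℝ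
  | .inl _ => 0
  | .inr (.inl k) => -((t.t (t.right k).succ : ℝ) - (t.t (t.left k).castSucc : ℝ))
  | .inr (.inr ⟨k, l⟩) => (t.size k : ℝ) - ((l : ℝ) + 1)

end RightLimits

/-! ### The p-value attached to a linear statistic and a polyhedron -/

section PValue

variable {ι L : Type*} [Fintype ι]

/-- `c = Σ η (ηᵀ Σ η)⁻¹`. -/
noncomputable def cVec (Sig : Matrix ι ι ℝ) (η : ι → ℝ) : ι → ℝ :=
  (η ⬝ᵥ Sig *ᵥ η)⁻¹ • (Sig *ᵥ η)

/-- `Z(x) = (I - c ηᵀ) x`. -/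
noncomputable def zVec (Sig : Matrix ι ι ℝ) (η x : ι → ℝ) : ι → ℝ :=
  x - (η ⬝ᵥ x) • cVec Sig η

/-- `V⁻(z)` for the polyhedron `{A x ≤ b}`; the maximum over the empty set is `-∞`. -/
noncomputable def vMinus (A : Matrix L ι ℝ) (b : L → ℝ) (c z : ι → ℝ) : EReal :=
  ⨆ (l : L) (_ : (A *ᵥ c) l < 0), (((b l - (A *ᵥ z) l) / (A *ᵥ c) l : ℝ) : EReal)

/-- `V⁺(z)` for the polyhedron `{A x ≤ b}`; the minimum over the empty set is `+∞`. -/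
noncomputable def vPlus (A : Matrix L ι ℝ) (b : L → ℝ) (c z : ι → ℝ) : EReal :=
  ⨅ (l : L) (_ : 0 < (A *ᵥ c) l), (((b l - (A *ᵥ z) l) / (A *ᵥ c) l : ℝ) : EReal)

/-- Cumulative distribution function of the Gaussian distribution `N(ν, τ²)` truncated on
(that is, conditioned to belong to) the interval `[a, b]`, with possibly infinite end points. -/
noncomputable def truncGaussianCDF (ν : ℝ) (τ2 : NNReal) (a b : EReal) (x : ℝ) : ℝ :=
  ((gaussianReal ν τ2)[|{u : ℝ | a ≤ (u : EReal) ∧ (u : EReal) ≤ b}]).real (Set.Iic x)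

/-- The invariant statistic `T`. -/
noncomputable def invStat (Sig : Matrix ι ι ℝ) (η : ι → ℝ) (A : Matrix L ι ℝ) (b : L → ℝ)
    (x : ι → ℝ) : ℝ :=
  truncGaussianCDF 0 (η ⬝ᵥ Sig *ᵥ η).toNNReal
    (vMinus A b (cVec Sig η) (zVec Sig η x)) (vPlus A b (cVec Sig η) (zVec Sig η x)) (η ⬝ᵥ x)

/-- The two-sided p-value `2 min (T, 1 - T)`. -/
noncomputable def pvalPoly (Sig : Matrix ι ι ℝ) (η : ι → ℝ) (A : Matrix L ι ℝ) (b : L → ℝ)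
    (x : ι → ℝ) : ℝ :=
  2 * min (invStat Sig η A b x) (1 - invStat Sig η A b x)

end PValue

/-! ### The `p`-dimensional setting -/

/-- The tuples `(t^{(j)}, σ^{(j)})_j`, one right-limit sequence and one permutation per column. -/
abbrev Tuple (n p : ℕ) : Type := Fin p → RightLimits n × Equiv.Perm (Fin n)

namespace Tuple

variable {n p : ℕ} (e : Tuple n p)

/-- The block diagonal matrix with diagonal blocks `M(t^{(j)})`. The columns are indexed as the
coordinates of `Matrix.vec`, by pairs `(j, i)` (column `j`, row `i` of the data matrix). -/
noncomputable def bigM : Matrix (Σ j : Fin p, (e j).1.Row) (Fin p × Fin n) ℝ :=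
  Matrix.of fun r q => if r.1 = q.1 then (e r.1).1.M r.2 q.2 else 0

/-- The vector obtained by stacking the vectors `m(t^{(j)})`. -/
noncomputable def bigm : (Σ j : Fin p, (e j).1.Row) → ℝ := fun r => (e r.1).1.m r.2

/-- The block diagonal matrix with diagonal blocks the permutation matrices `P_{σ^{(j)}}`, where
`P_σ x = (x_{σ(1)}, ..., x_{σ(n)})`. -/
noncomputable def bigD : Matrix (Fin p × Fin n) (Fin p × Fin n) ℝ :=
  Matrix.of fun q q' => if q.1 = q'.1 then (e q.1).2.permMatrix ℝ q.2 q'.2 else 0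

/-- The p-value of the data matrix `y` for the hypothesis `κᵀ β = 0`, when the columns have
covariance `Γ` and yield the clusterings and orders encoded by the tuple `e`. -/
noncomputable def pval (lam : ℝ) (Γ : Matrix (Fin p × Fin n) (Fin p × Fin n) ℝ)
    (κ : Fin p × Fin n → ℝ) (y : Matrix (Fin n) (Fin p) ℝ) : ℝ :=
  pvalPoly Γ κ (e.bigM * e.bigD) (lam • e.bigm) (Matrix.vec y)

end Tuple

end ConvClust

/-! For a fixed tuple `e`, the event that the procedure outputs `e` is, up to a null set, the
polyhedron `A vec(Y) ≤ b`. Whether `κ(e)ᵀβ = 0` holds is determined by `e`, so the conditioning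
event is a countable disjoint union of such pieces, and uniformity on each piece suffices
(`hasLaw_cond_of_pieces`).

On one piece the direction is frozen. Write `x = z + w c` with `w = κᵀx`; the vector `c` makes `w`
and `z` uncorrelated, hence independent (`indepFun_dotProduct_zVec`). For fixed `z` the polyhedron
either is empty or confines `w` to `[V⁻, V⁺]`. Since `w` is centred Gaussian, its truncated
distribution function evaluated at `w` is uniform, and `t ↦ 2 min(t, 1 - t)` preserves the uniform
law. Integrating over `z` gives `measure_polyhedron_inter_pvalPoly`.

The polyhedron comes from the optimality conditions. For sorted data, sorting a competitor does not
raise the objective, and on decreasing vectors the penalty is linear. Optimality of a vector that is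
constant on segments then says that, on each segment, the prefix sums of the gradient are
nonnegative and the total is zero. The zero total fixes the common value; the rest are the rows of
`M(t)`. They are necessary (`M_mulVec_le_of_isClusteringOf`), and sufficient unless two adjacent
values coincide (`isSolution_and_isClusteringOf_of_M_mulVec_le`). Such coincidences, like ties in
the data, lie in hyperplanes, which a nondegenerate Gaussian vector almost surely avoids. -/

namespace ConvClust

/-! ### Linear statistics of a Gaussian vector. -/

section GaussianLaw

variable {ι : Type*} [Fintype ι]

lemma dotProduct_mulVec_pos {Γ : Matrix ι ι ℝ} (hΓ : Γ.PosDef) {a : ι → ℝ} (ha : a ≠ 0) :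
    0 < a ⬝ᵥ Γ *ᵥ a := by
  simpa using hΓ.dotProduct_mulVec_pos ha

variable [DecidableEq ι]

lemma memLp_dotProduct_gaussian (β : ι → ℝ) (Γ : Matrix ι ι ℝ) (a : ι → ℝ) :
    MemLp (fun x : EuclideanSpace ℝ ι => a ⬝ᵥ x.ofLp) 2
      (multivariateGaussian (WithLp.toLp 2 β) Γ) := by
  have h : (fun x : EuclideanSpace ℝ ι => a ⬝ᵥ x.ofLp)
      = fun x => innerSL ℝ (WithLp.toLp 2 a) x := by
    ext x; simp [PiLp.inner_apply, dotProduct, mul_comm]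
  rw [h]
  exact (IsGaussian.hasGaussianLaw_id.map_fun (innerSL ℝ (WithLp.toLp 2 a))).memLp_two

/-- Covariance of two linear statistics of a Gaussian vector. -/
lemma covariance_dotProduct_gaussian (β : ι → ℝ) {Γ : Matrix ι ι ℝ} (hΓ : Γ.PosSemidef)
    (a b : ι → ℝ) :
    cov[fun x : EuclideanSpace ℝ ι => a ⬝ᵥ x.ofLp, fun x => b ⬝ᵥ x.ofLp;
      multivariateGaussian (WithLp.toLp 2 β) Γ] = a ⬝ᵥ Γ *ᵥ b := by
  have h (a : ι → ℝ) : (fun x : EuclideanSpace ℝ ι => a ⬝ᵥ x.ofLp)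
      = fun x => inner ℝ (WithLp.toLp 2 a) x := by
    ext x; simp [PiLp.inner_apply, dotProduct, mul_comm]
  rw [h a, h b, ← covarianceBilin_apply_eq_cov IsGaussian.memLp_two_id,
    covarianceBilin_multivariateGaussian hΓ]

/-- A linear statistic of a Gaussian vector is a Gaussian variable. -/
lemma map_dotProduct_gaussian (β : ι → ℝ) {Γ : Matrix ι ι ℝ} (hΓ : Γ.PosSemidef) (a : ι → ℝ) :
    (multivariateGaussian (WithLp.toLp 2 β) Γ).map (fun x => a ⬝ᵥ x.ofLp)
      = gaussianReal (a ⬝ᵥ β) (a ⬝ᵥ Γ *ᵥ a).toNNReal := by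
  have h : (fun x : EuclideanSpace ℝ ι => a ⬝ᵥ x.ofLp)
      = fun x => innerSL ℝ (WithLp.toLp 2 a) x := by
    ext x; simp [PiLp.inner_apply, dotProduct, mul_comm]
  have hv := covariance_dotProduct_gaussian β hΓ a a
  rw [covariance_self (memLp_dotProduct_gaussian β Γ a).aemeasurable] at hv
  rw [← hv, h, IsGaussian.map_eq_gaussianReal, ContinuousLinearMap.integral_comp_id_comm]
  · simp [PiLp.inner_apply, dotProduct, mul_comm]
  · exact IsGaussian.integrable_id

/-- A nondegenerate Gaussian vector almost surely avoids a given hyperplane. -/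
lemma ae_dotProduct_ne_gaussian (β : ι → ℝ) {Γ : Matrix ι ι ℝ} (hΓ : Γ.PosDef) {a : ι → ℝ}
    (ha : a ≠ 0) (r : ℝ) :
    ∀ᵐ x ∂(multivariateGaussian (WithLp.toLp 2 β) Γ), a ⬝ᵥ x.ofLp ≠ r := by
  have hm : Measurable fun x : EuclideanSpace ℝ ι => a ⬝ᵥ x.ofLp := by
    unfold dotProduct; fun_prop
  have hv : (a ⬝ᵥ Γ *ᵥ a).toNNReal ≠ 0 := by
    simpa using dotProduct_mulVec_pos hΓ ha
  have := nullSingletonClass_gaussianReal (μ := a ⬝ᵥ β) hv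
  have h0 : (gaussianReal (a ⬝ᵥ β) (a ⬝ᵥ Γ *ᵥ a).toNNReal) {r} = 0 := measure_singleton r
  rw [← map_dotProduct_gaussian β hΓ.posSemidef, Measure.map_apply hm (measurableSet_singleton r)]
    at h0
  exact measure_eq_zero_iff_ae_notMem.1 h0

/-- `ηᵀ X` and `Z(X)` are independent. -/
lemma indepFun_dotProduct_zVec (β : ι → ℝ) {Γ : Matrix ι ι ℝ} (hΓ : Γ.PosDef) {η : ι → ℝ}
    (hη : η ≠ 0) :
    IndepFun (fun x : EuclideanSpace ℝ ι => η ⬝ᵥ x.ofLp) (fun x => zVec Γ η x.ofLp)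
      (multivariateGaussian (WithLp.toLp 2 β) Γ) := by
  -- Zero covariance yields independence only for a jointly Gaussian pair; joint Gaussianity holds
  -- because the pair is a continuous linear image of the vector. The factor `Unit → ℝ` presents the
  -- scalar as a family.
  have hlin : ∃ L : EuclideanSpace ℝ ι →L[ℝ] (Unit → ℝ) × (ι → ℝ),
      ∀ x, L x = (fun _ => η ⬝ᵥ x.ofLp, fun i => zVec Γ η x.ofLp i) := by
    let L : EuclideanSpace ℝ ι →ₗ[ℝ] (Unit → ℝ) × (ι → ℝ) :=
      { toFun := fun x => (fun _ => η ⬝ᵥ x.ofLp, fun i => zVec Γ η x.ofLp i)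
        map_add' := by
          intro x y
          ext i
          · simp [dotProduct_add]
          · simp [zVec, dotProduct_add]; ring
        map_smul' := by
          intro r x
          ext i
          · simp [dotProduct_smul]
          · simp [zVec, dotProduct_smul]; ring }
    exact ⟨L.toContinuousLinearMap, fun x => rfl⟩
  obtain ⟨L, hL⟩ := hlin
  have hpos := dotProduct_mulVec_pos hΓ hη
  have key := HasGaussianLaw.indepFun_of_covariance_eval
    (P := multivariateGaussian (WithLp.toLp 2 β) Γ)
    (X := fun (_ : Unit) (x : EuclideanSpace ℝ ι) => η ⬝ᵥ x.ofLp)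
    (Y := fun i x => zVec Γ η x.ofLp i)
    (by
      have := (IsGaussian.hasGaussianLaw_id
        (μ := multivariateGaussian (WithLp.toLp 2 β) Γ)).map_fun L
      simpa [hL] using this) (by
      intro _ i
      -- Each coordinate of `Z` is itself a linear statistic, so its covariance with `ηᵀX` is
      -- `(Γη)_i - c_i ηᵀΓη`, which vanishes by the choice of `c`.
      have h2 : (fun x : EuclideanSpace ℝ ι => zVec Γ η x.ofLp i)
          = fun x => (Pi.single i 1 - cVec Γ η i • η) ⬝ᵥ x.ofLp := by
        ext x; simp [zVec, sub_dotProduct, smul_dotProduct]; ring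
      simp only [h2]
      rw [covariance_dotProduct_gaussian β hΓ.posSemidef, mulVec_sub, mulVec_smul, dotProduct_sub,
        dotProduct_smul]
      have h3 : η ⬝ᵥ Γ *ᵥ Pi.single i 1 = (Γ *ᵥ η) i := by
        have : Γᵀ = Γ := by simpa using hΓ.isHermitian.eq
        rw [dotProduct_mulVec, ← mulVec_transpose, this, dotProduct_single_one]
      rw [h3]
      simp only [cVec, Pi.smul_apply, smul_eq_mul]
      field_simp
      ring)
  have hev : Measurable fun f : Unit → ℝ => f () := measurable_pi_apply ()
  exact key.comp hev measurable_id

end GaussianLaw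

/-! ### Probability integral transform and its two-sided version. -/

section ProbabilityIntegralTransform

/-- The probability integral transform. -/
lemma map_real_Iic_eq_uniform (μ : Measure ℝ) [IsProbabilityMeasure μ] [NullSingletonClass μ] :
    μ.map (fun x => μ.real (Set.Iic x)) = volume.restrict (Set.Icc (0 : ℝ) 1) := by
  set F : ℝ → ℝ := fun x => μ.real (Set.Iic x) with hF
  have hmono : Monotone F := fun x y h => measureReal_mono (Set.Iic_subset_Iic.2 h)
  have hFc : F = cdf μ := by ext x; rw [cdf_eq_real]
  have hcont : Continuous F := by
    rw [continuous_iff_continuousAt]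
    intro x
    -- The jump of the distribution function at `x` is the mass of `{x}`, hence zero.
    have h1 := StieltjesFunction.measure_singleton (cdf μ) x
    rw [measure_cdf, measure_singleton] at h1
    rw [hFc, (monotone_cdf μ).continuousAt_iff_leftLim_eq_rightLim, StieltjesFunction.rightLim_eq]
    have h2 : cdf μ x - Function.leftLim (cdf μ) x ≤ 0 := by
      simpa using h1.symm
    exact le_antisymm ((monotone_cdf μ).leftLim_le le_rfl) (by linarith)
  have hsurj : ∀ y ∈ Set.Ioo (0 : ℝ) 1, ∃ x, F x = y := by
    intro y hy
    have hbot := tendsto_cdf_atBot μ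
    have htop := tendsto_cdf_atTop μ
    rw [← hFc] at hbot htop
    exact mem_range_of_exists_le_of_exists_ge hcont
      ((hbot.eventually_le_const hy.1).exists) ((htop.eventually_const_le hy.2).exists)
  have hlt : ∀ y ∈ Set.Ioo (0 : ℝ) 1, μ {x | F x < y} ≤ ENNReal.ofReal y := by
    intro y hy
    obtain ⟨x, hx⟩ := hsurj y hy
    calc μ {x | F x < y} ≤ μ (Set.Iic x) := measure_mono fun z hz => by
          by_contra h
          exact absurd (hmono (not_le.1 h).le) (by rw [hx]; exact not_le.2 hz)
      _ = ENNReal.ofReal y := by rw [← hx, hF, ofReal_measureReal]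
  have hm : Measurable F := hcont.measurable
  have : IsProbabilityMeasure (μ.map F) := Measure.isProbabilityMeasure_map hm.aemeasurable
  refine Measure.ext_of_Iic _ _ fun y => ?_
  rw [Measure.map_apply hm measurableSet_Iic, Measure.restrict_apply measurableSet_Iic]
  rcases lt_or_ge y 0 with hy0 | hy0
  · have e1 : F ⁻¹' Set.Iic y = ∅ := by
      ext x; simp only [Set.mem_preimage, Set.mem_Iic, Set.mem_empty_iff_false, iff_false, not_le]
      exact hy0.trans_le measureReal_nonneg
    have e2 : Set.Iic y ∩ Set.Icc 0 1 = ∅ := by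
      ext x; simp; intro h1 h2; linarith
    simp [e1, e2]
  rcases le_or_gt 1 y with hy1 | hy1
  · have e1 : F ⁻¹' Set.Iic y = Set.univ := by
      ext x; simp only [Set.mem_preimage, Set.mem_Iic, Set.mem_univ, iff_true]
      exact measureReal_le_one.trans hy1
    have e2 : Set.Iic y ∩ Set.Icc 0 1 = Set.Icc 0 1 := by
      ext x; simp; intro h1 h2; linarith
    simp [e1, e2]
  have e2 : Set.Iic y ∩ Set.Icc 0 1 = Set.Icc 0 y := by
    ext x; simp; constructor
    · rintro ⟨h1, h2, h3⟩; exact ⟨h2, h1⟩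
    · rintro ⟨h1, h2⟩; exact ⟨h2, h1, by linarith⟩
  rw [e2, Real.volume_Icc, sub_zero]
  refine le_antisymm ?_ ?_
  -- `F` may be flat at level `y`, so `{F ≤ y}` can exceed a given half-line `Iic x` with `F x = y`.
  -- It is bounded instead by `{F < z}`, with `z` decreasing to `y`.
  · have hlim : Filter.Tendsto (fun z => ENNReal.ofReal z) (nhdsWithin y (Set.Ioi y))
        (nhds (ENNReal.ofReal y)) :=
      (ENNReal.continuous_ofReal.tendsto y).mono_left nhdsWithin_le_nhds
    refine ge_of_tendsto hlim ?_
    filter_upwards [Ioo_mem_nhdsGT hy1] with z hz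
    refine le_trans (measure_mono ?_) (hlt z ⟨hy0.trans_lt hz.1, hz.2⟩)
    intro x hx
    exact lt_of_le_of_lt hx hz.1
  · rcases hy0.eq_or_lt with rfl | hy0
    · simp
    obtain ⟨x, hx⟩ := hsurj y ⟨hy0, hy1⟩
    calc ENNReal.ofReal y = μ (Set.Iic x) := by rw [← hx, hF, ofReal_measureReal]
      _ ≤ μ (F ⁻¹' Set.Iic y) := measure_mono fun z hz => (hmono hz).trans hx.le

/-- The two-sided transformation preserves the uniform distribution on `[0, 1]`. -/
lemma map_two_mul_min_uniform :
    (volume.restrict (Set.Icc (0 : ℝ) 1)).map (fun t => 2 * min t (1 - t))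
      = volume.restrict (Set.Icc (0 : ℝ) 1) := by
  have hm : Measurable fun t : ℝ => 2 * min t (1 - t) := by fun_prop
  refine Measure.ext_of_Iic _ _ fun y => ?_
  rw [Measure.map_apply hm measurableSet_Iic, Measure.restrict_apply measurableSet_Iic,
    Measure.restrict_apply (hm measurableSet_Iic)]
  rcases lt_or_ge y 0 with hy0 | hy0
  · have e1 : (fun t : ℝ => 2 * min t (1 - t)) ⁻¹' Set.Iic y ∩ Set.Icc 0 1 = ∅ := by
      ext x
      simp only [Set.mem_inter_iff, Set.mem_preimage, Set.mem_Iic, Set.mem_Icc,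
        Set.mem_empty_iff_false, iff_false]
      rintro ⟨h1, h2, h3⟩
      have : 0 ≤ min x (1 - x) := le_min h2 (by linarith)
      linarith
    have e2 : Set.Iic y ∩ Set.Icc 0 1 = ∅ := by
      ext x; simp; intro h1 h2; linarith
    simp [e1, e2]
  rcases le_or_gt 1 y with hy1 | hy1
  · have e1 : (fun t : ℝ => 2 * min t (1 - t)) ⁻¹' Set.Iic y ∩ Set.Icc 0 1 = Set.Icc 0 1 := by
      ext x
      simp only [Set.mem_inter_iff, Set.mem_preimage, Set.mem_Iic, Set.mem_Icc,
        and_iff_right_iff_imp]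
      rintro ⟨h2, h3⟩
      have h4 := min_le_left x (1 - x)
      have h5 := min_le_right x (1 - x)
      linarith
    have e2 : Set.Iic y ∩ Set.Icc 0 1 = Set.Icc 0 1 := by
      ext x; simp; intro h1 h2; linarith
    simp [e1, e2]
  have e1 : (fun t : ℝ => 2 * min t (1 - t)) ⁻¹' Set.Iic y ∩ Set.Icc 0 1
      = Set.Icc 0 (y / 2) ∪ Set.Icc (1 - y / 2) 1 := by
    ext x
    simp only [Set.mem_inter_iff, Set.mem_preimage, Set.mem_Iic, Set.mem_Icc, Set.mem_union]
    rcases min_cases x (1 - x) with ⟨h, h'⟩ | ⟨h, h'⟩ <;> rw [h] <;> constructor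
    · rintro ⟨h1, h2, h3⟩; left; constructor <;> linarith
    · rintro (⟨h1, h2⟩ | ⟨h1, h2⟩) <;> refine ⟨?_, ?_, ?_⟩ <;> linarith
    · rintro ⟨h1, h2, h3⟩; right; constructor <;> linarith
    · rintro (⟨h1, h2⟩ | ⟨h1, h2⟩) <;> refine ⟨?_, ?_, ?_⟩ <;> linarith
  have e2 : Set.Iic y ∩ Set.Icc 0 1 = Set.Icc 0 y := by
    ext x; simp; constructor
    · rintro ⟨h1, h2, h3⟩; exact ⟨h2, h1⟩
    · rintro ⟨h1, h2⟩; exact ⟨h2, h1, by linarith⟩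
  have hd : Disjoint (Set.Icc (0 : ℝ) (y / 2)) (Set.Icc (1 - y / 2) 1) := by
    rw [Set.disjoint_left]
    rintro x ⟨h1, h2⟩ ⟨h3, h4⟩
    linarith
  rw [e1, e2, measure_union hd measurableSet_Icc, Real.volume_Icc, Real.volume_Icc,
    Real.volume_Icc, ← ENNReal.ofReal_add (by linarith) (by linarith)]
  congr 1
  ring

end ProbabilityIntegralTransform


/-! ### The polyhedral lemma. -/

section Polyhedron

/-- The two-sided p-value of a truncated distribution is uniform. -/
lemma measure_inter_truncated_pvalue (μ : Measure ℝ) [IsProbabilityMeasure μ]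
    [NullSingletonClass μ] {I : Set ℝ} (hI : MeasurableSet I) {U : Set ℝ} (hU : MeasurableSet U) :
    μ (I ∩ {w | 2 * min (μ[|I].real (Set.Iic w)) (1 - μ[|I].real (Set.Iic w)) ∈ U})
      = μ I * volume.restrict (Set.Icc (0 : ℝ) 1) U := by
  -- On a null interval the conditional measure is not a probability, but both sides vanish.
  by_cases h0 : μ I = 0
  · rw [h0, zero_mul]
    exact measure_mono_null Set.inter_subset_left h0
  have : IsProbabilityMeasure μ[|I] := cond_isProbabilityMeasure h0
  have : NullSingletonClass μ[|I] := ⟨fun x =>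
    cond_absolutelyContinuous (measure_singleton x)⟩
  have hF : Measurable fun w => μ[|I].real (Set.Iic w) := by
    refine Monotone.measurable fun x y h => measureReal_mono (Set.Iic_subset_Iic.2 h)
  have hm : Measurable fun t : ℝ => 2 * min t (1 - t) := by fun_prop
  have h1 := map_two_mul_min_uniform
  rw [← map_real_Iic_eq_uniform μ[|I], Measure.map_map hm hF, map_real_Iic_eq_uniform μ[|I]] at h1
  rw [← cond_mul_eq_inter hI, mul_comm, ← h1, Measure.map_apply (hm.comp hF) hU]
  rfl

variable {ι L : Type*} [Fintype ι]

lemma measurable_mulVec_apply {M : Matrix L ι ℝ} (l : L) :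
    Measurable fun z : ι → ℝ => (M *ᵥ z) l := by
  unfold mulVec dotProduct; fun_prop

lemma measurable_vMinus [Countable L] (A : Matrix L ι ℝ) (b : L → ℝ) (c : ι → ℝ) :
    Measurable (vMinus A b c) := by
  refine Measurable.iSup fun l => Measurable.iSup fun _ => ?_
  exact (((measurable_mulVec_apply l).const_sub _).div_const _).coe_real_ereal

lemma measurable_vPlus [Countable L] (A : Matrix L ι ℝ) (b : L → ℝ) (c : ι → ℝ) :
    Measurable (vPlus A b c) := by
  refine Measurable.iInf fun l => Measurable.iInf fun _ => ?_
  exact (((measurable_mulVec_apply l).const_sub _).div_const _).coe_real_ereal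

lemma measurable_zVec (Sig : Matrix ι ι ℝ) (η : ι → ℝ) : Measurable (zVec Sig η) := by
  unfold zVec dotProduct; fun_prop

lemma measurableSet_truncInterval (a b : EReal) :
    MeasurableSet {u : ℝ | a ≤ (u : EReal) ∧ (u : EReal) ≤ b} :=
  (measurableSet_le measurable_const measurable_coe_real_ereal).inter
    (measurableSet_le measurable_coe_real_ereal measurable_const)

/-- Joint measurability of the truncated Gaussian distribution function. -/
lemma measurable_truncGaussianCDF {X : Type*} [MeasurableSpace X] (ν : ℝ) (τ2 : NNReal)
    {a b : X → EReal} {w : X → ℝ} (ha : Measurable a) (hb : Measurable b) (hw : Measurable w) :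
    Measurable fun x => truncGaussianCDF ν τ2 (a x) (b x) (w x) := by
  have hI : MeasurableSet {q : X × ℝ | a q.1 ≤ (q.2 : EReal) ∧ (q.2 : EReal) ≤ b q.1} :=
    (measurableSet_le (ha.comp measurable_fst) measurable_snd.coe_real_ereal).inter
      (measurableSet_le measurable_snd.coe_real_ereal (hb.comp measurable_fst))
  have hW : MeasurableSet {q : X × ℝ | q.2 ≤ w q.1} :=
    measurableSet_le measurable_snd (hw.comp measurable_fst)
  have h1 := measurable_measure_prodMk_left (ν := gaussianReal ν τ2) hI
  have h2 := measurable_measure_prodMk_left (ν := gaussianReal ν τ2) (hI.inter hW)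
  -- The truncated distribution function is a ratio of measures of sections of two measurable sets
  -- of the product, and such measures depend measurably on the base point.
  have : (fun x => truncGaussianCDF ν τ2 (a x) (b x) (w x)) = fun x =>
      ((gaussianReal ν τ2 (Prod.mk x ⁻¹'
          {q : X × ℝ | a q.1 ≤ (q.2 : EReal) ∧ (q.2 : EReal) ≤ b q.1}))⁻¹ *
        gaussianReal ν τ2 (Prod.mk x ⁻¹'
          ({q : X × ℝ | a q.1 ≤ (q.2 : EReal) ∧ (q.2 : EReal) ≤ b q.1} ∩
            {q : X × ℝ | q.2 ≤ w q.1}))).toReal := by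
    ext x
    rw [truncGaussianCDF, measureReal_def, cond_apply (measurableSet_truncInterval _ _)]
    rfl
  rw [this]
  exact (h1.inv.mul h2).ennreal_toReal

lemma measurable_pvalPoly [Countable L] (Sig : Matrix ι ι ℝ) (η : ι → ℝ) (A : Matrix L ι ℝ)
    (b : L → ℝ) : Measurable (pvalPoly Sig η A b) := by
  have hd : Measurable fun x : ι → ℝ => η ⬝ᵥ x := by unfold dotProduct; fun_prop
  have : Measurable (invStat Sig η A b) := measurable_truncGaussianCDF _ _
    ((measurable_vMinus A b _).comp (measurable_zVec Sig η))
    ((measurable_vPlus A b _).comp (measurable_zVec Sig η)) hd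
  unfold pvalPoly
  fun_prop

lemma measurableSet_polyhedron [Countable L] (A : Matrix L ι ℝ) (b : L → ℝ) :
    MeasurableSet {x : ι → ℝ | A *ᵥ x ≤ b} := by
  simp only [Pi.le_def, Set.ofPred_forall]
  exact MeasurableSet.iInter fun l => measurableSet_le (measurable_mulVec_apply l) measurable_const

/-- Membership in a polyhedron, in terms of the position `w` along the direction `c`. -/
lemma mulVec_add_smul_le_iff (A : Matrix L ι ℝ) (b : L → ℝ) (c z : ι → ℝ) (w : ℝ) :
    A *ᵥ (z + w • c) ≤ b ↔ (∀ l, (A *ᵥ c) l = 0 → (A *ᵥ z) l ≤ b l) ∧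
      vMinus A b c z ≤ (w : EReal) ∧ (w : EReal) ≤ vPlus A b c z := by
  simp only [vMinus, vPlus, iSup_le_iff, le_iInf_iff, EReal.coe_le_coe_iff, Pi.le_def, mulVec_add,
    mulVec_smul, Pi.add_apply, Pi.smul_apply, smul_eq_mul]
  constructor
  · intro h
    refine ⟨fun l hl => by simpa [hl] using h l, fun l hl => ?_, fun l hl => ?_⟩
    · rw [div_le_iff_of_neg hl]; linarith [h l]
    · rw [le_div_iff₀ hl]; linarith [h l]
  · rintro ⟨h0, h1, h2⟩ l
    -- Along the line `z + w c`, a row gives a lower bound on `w`, no condition on `w`, or an upper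
    -- bound, according to the sign of `(Ac)_l`.
    rcases lt_trichotomy ((A *ᵥ c) l) 0 with hl | hl | hl
    · have := h1 l hl
      rw [div_le_iff_of_neg hl] at this; linarith
    · simpa [hl] using h0 l hl
    · have := h2 l hl
      rw [le_div_iff₀ hl] at this; linarith

/-- **Polyhedral lemma**: conditionally on a polyhedral event, the p-value is uniform. -/
theorem measure_polyhedron_inter_pvalPoly [DecidableEq ι] [Countable L] (β : ι → ℝ)
    {Γ : Matrix ι ι ℝ} (hΓ : Γ.PosDef) {η : ι → ℝ} (hη : η ≠ 0) (h0 : η ⬝ᵥ β = 0)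
    (A : Matrix L ι ℝ) (b : L → ℝ) {U : Set ℝ} (hU : MeasurableSet U) :
    multivariateGaussian (WithLp.toLp 2 β) Γ
        ({x | A *ᵥ x.ofLp ≤ b} ∩ {x | pvalPoly Γ η A b x.ofLp ∈ U})
      = multivariateGaussian (WithLp.toLp 2 β) Γ {x | A *ᵥ x.ofLp ≤ b} *
          volume.restrict (Set.Icc (0 : ℝ) 1) U := by
  set M := multivariateGaussian (WithLp.toLp 2 β) Γ with hM
  set c := cVec Γ η with hc
  set v := (η ⬝ᵥ Γ *ᵥ η).toNNReal with hv
  have hv0 : v ≠ 0 := by simpa [hv] using dotProduct_mulVec_pos hΓ hη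
  have := nullSingletonClass_gaussianReal (μ := 0) hv0
  have hd : Measurable fun x : ι → ℝ => η ⬝ᵥ x := by unfold dotProduct; fun_prop
  have hW : Measurable fun x : EuclideanSpace ℝ ι => η ⬝ᵥ x.ofLp := hd.comp (by fun_prop)
  have hZ : Measurable fun x : EuclideanSpace ℝ ι => zVec Γ η x.ofLp :=
    (measurable_zVec Γ η).comp (by fun_prop)
  have hmapW : M.map (fun x => η ⬝ᵥ x.ofLp) = gaussianReal 0 v := by
    rw [hM, map_dotProduct_gaussian β hΓ.posSemidef, h0]
  have hjoint : M.map (fun x => (η ⬝ᵥ x.ofLp, zVec Γ η x.ofLp))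
      = (gaussianReal 0 v).prod (M.map fun x => zVec Γ η x.ofLp) := by
    rw [← hmapW]
    exact (indepFun_iff_map_prod_eq_prod_map_map hW.aemeasurable hZ.aemeasurable).1
      (indepFun_dotProduct_zVec β hΓ hη)
  have hprobZ : IsProbabilityMeasure (M.map fun x => zVec Γ η x.ofLp) :=
    Measure.isProbabilityMeasure_map hZ.aemeasurable
  let I : (ι → ℝ) → Set ℝ := fun z =>
    {u : ℝ | vMinus A b c z ≤ (u : EReal) ∧ (u : EReal) ≤ vPlus A b c z}
  let D : Set (ℝ × (ι → ℝ)) :=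
    {q | (∀ l, (A *ᵥ c) l = 0 → (A *ᵥ q.2) l ≤ b l) ∧ q.1 ∈ I q.2}
  let t : ℝ × (ι → ℝ) → ℝ := fun q => truncGaussianCDF 0 v (vMinus A b c q.2) (vPlus A b c q.2) q.1
  let R : Set (ℝ × (ι → ℝ)) := {q | 2 * min (t q) (1 - t q) ∈ U}
  have hvm : Measurable fun q : ℝ × (ι → ℝ) => vMinus A b c q.2 :=
    (measurable_vMinus A b c).comp measurable_snd
  have hvp : Measurable fun q : ℝ × (ι → ℝ) => vPlus A b c q.2 :=
    (measurable_vPlus A b c).comp measurable_snd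
  have hD : MeasurableSet D := by
    have hN : MeasurableSet
        {q : ℝ × (ι → ℝ) | ∀ l, (A *ᵥ c) l = 0 → (A *ᵥ q.2) l ≤ b l} := by
      simp only [Set.ofPred_forall]
      exact MeasurableSet.iInter fun l => MeasurableSet.iInter fun _ =>
        measurableSet_le ((measurable_mulVec_apply l).comp measurable_snd) measurable_const
    exact hN.inter ((measurableSet_le hvm measurable_fst.coe_real_ereal).inter
      (measurableSet_le measurable_fst.coe_real_ereal hvp))
  have ht : Measurable t := measurable_truncGaussianCDF 0 v hvm hvp measurable_fst
  have hR : MeasurableSet R := by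
    have : Measurable fun q => 2 * min (t q) (1 - t q) := by fun_prop
    exact this hU
  have hpoly : {x : EuclideanSpace ℝ ι | A *ᵥ x.ofLp ≤ b}
      = (fun x => (η ⬝ᵥ x.ofLp, zVec Γ η x.ofLp)) ⁻¹' D := by
    ext x
    have hx : x.ofLp = zVec Γ η x.ofLp + (η ⬝ᵥ x.ofLp) • c := by simp [zVec, hc]
    have := mulVec_add_smul_le_iff A b c (zVec Γ η x.ofLp) (η ⬝ᵥ x.ofLp)
    rw [← hx] at this
    exact this
  have hpval : {x : EuclideanSpace ℝ ι | pvalPoly Γ η A b x.ofLp ∈ U}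
      = (fun x => (η ⬝ᵥ x.ofLp, zVec Γ η x.ofLp)) ⁻¹' R := rfl
  rw [hpval, hpoly, ← Set.preimage_inter, ← Measure.map_apply (hW.prodMk hZ) (hD.inter hR),
    ← Measure.map_apply (hW.prodMk hZ) hD, hjoint, Measure.prod_apply_symm (hD.inter hR),
    Measure.prod_apply_symm hD, ← lintegral_mul_const _ (measurable_measure_prodMk_right hD)]
  refine lintegral_congr fun z => ?_
  -- The rows with `(Ac)_l = 0` involve `z` alone: if they hold, the fibre over `z` is exactly the
  -- truncation interval; otherwise it is empty.
  by_cases hz : ∀ l, (A *ᵥ c) l = 0 → (A *ᵥ z) l ≤ b l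
  · have e1 : (fun w => (w, z)) ⁻¹' D = I z := by
      ext w; simp only [Set.mem_preimage, D, Set.mem_ofPred_eq, and_iff_right hz]
    rw [Set.preimage_inter, e1]
    exact measure_inter_truncated_pvalue (gaussianReal 0 v) (measurableSet_truncInterval _ _) hU
  · have e1 : (fun w => (w, z)) ⁻¹' D = ∅ := by
      ext w; simp only [Set.mem_preimage, D, Set.mem_ofPred_eq, hz, false_and,
        Set.mem_empty_iff_false]
    rw [Set.preimage_inter, e1]
    simp

end Polyhedron


/-! ### Optimality conditions for one-dimensional convex clustering. -/

section Clustering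

variable {n : ℕ}

/-- The fusion penalty `∑_{i < i'} |B i' - B i|`. -/
noncomputable def fusion (B : Fin n → ℝ) : ℝ :=
  ∑ i, ∑ i' ∈ Finset.univ.filter (fun i' => i < i'), |B i' - B i|

lemma objective_eq (lam : ℝ) (x B : Fin n → ℝ) :
    objective lam x B = (1 / 2) * ∑ i, (B i - x i) ^ 2 + lam * fusion B := rfl

/-- Summing over all ordered pairs removes the reference to the order of the indices, so that
permutation invariance becomes a reindexing. -/
lemma two_mul_fusion (B : Fin n → ℝ) : 2 * fusion B = ∑ i, ∑ i', |B i' - B i| := by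
  have h1 : ∀ i i' : Fin n, |B i' - B i|
      = (if i < i' then |B i' - B i| else 0) + if i' < i then |B i - B i'| else 0 := by
    intro i i'
    rcases lt_trichotomy i i' with h | rfl | h
    · simp [h, h.le]
    · simp
    · simp [h, h.le, abs_sub_comm]
  have h2 : fusion B = ∑ i, ∑ i', if i < i' then |B i' - B i| else 0 := by
    simp only [fusion, Finset.sum_filter]
  have h3 : fusion B = ∑ i, ∑ i', if i' < i then |B i - B i'| else 0 := by
    rw [h2, Finset.sum_comm]
  calc 2 * fusion B = fusion B + fusion B := two_mul _
    _ = _ := by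
      nth_rewrite 1 [h2]
      rw [h3, ← Finset.sum_add_distrib]
      refine Finset.sum_congr rfl fun i _ => ?_
      rw [← Finset.sum_add_distrib]
      exact Finset.sum_congr rfl fun i' _ => (h1 i i').symm

lemma fusion_comp_perm (B : Fin n → ℝ) (σ : Equiv.Perm (Fin n)) : fusion (B ∘ σ) = fusion B := by
  have h : ∑ i, ∑ i', |B (σ i') - B (σ i)| = ∑ i, ∑ i', |B i' - B i| := by
    rw [← Equiv.sum_comp σ fun i => ∑ i', |B i' - B i|]
    exact Finset.sum_congr rfl fun i _ => Equiv.sum_comp σ fun i' => |B i' - B (σ i)|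
  have h1 := two_mul_fusion (B ∘ σ)
  have h2 := two_mul_fusion B
  simp only [Function.comp_apply] at h1
  linarith

lemma objective_comp_perm (lam : ℝ) (x B : Fin n → ℝ) (σ : Equiv.Perm (Fin n)) :
    objective lam (x ∘ σ) (B ∘ σ) = objective lam x B := by
  rw [objective_eq, objective_eq, fusion_comp_perm]
  congr 2
  exact Equiv.sum_comp σ fun i => (B i - x i) ^ 2

/-- This reduces every question about solutions to sorted observations. -/
lemma isSolution_comp_perm_iff (lam : ℝ) (x B : Fin n → ℝ) (σ : Equiv.Perm (Fin n)) :
    IsSolution lam (x ∘ σ) (B ∘ σ) ↔ IsSolution lam x B := by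
  constructor
  · intro h B'
    have := h (B' ∘ σ)
    rwa [objective_comp_perm, objective_comp_perm] at this
  · intro h B'
    have hB' : B' = (B' ∘ σ.symm) ∘ σ := by ext i; simp
    rw [hB', objective_comp_perm, objective_comp_perm]
    exact h _

/-- The convex clustering problem has at most one solution. -/
lemma IsSolution.unique {lam : ℝ} (hlam : 0 ≤ lam) {x B B' : Fin n → ℝ} (h : IsSolution lam x B)
    (h' : IsSolution lam x B') : B = B' := by
  -- Both minimizers are compared with their midpoint: the penalty is convex, while the
  -- parallelogram identity makes the quadratic part drop strictly unless they agree.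
  have hf : 2 * fusion (fun i => (B i + B' i) / 2) ≤ fusion B + fusion B' := by
    simp only [fusion, Finset.mul_sum, ← Finset.sum_add_distrib]
    refine Finset.sum_le_sum fun i _ => Finset.sum_le_sum fun j _ => ?_
    have e : 2 * |(B j + B' j) / 2 - (B i + B' i) / 2| = |(B j - B i) + (B' j - B' i)| := by
      rw [← abs_two, ← abs_mul, abs_two]; congr 1; ring
    rw [e]
    exact abs_add_le _ _
  have hq : 2 * ∑ i, ((B i + B' i) / 2 - x i) ^ 2
      = ∑ i, (B i - x i) ^ 2 + ∑ i, (B' i - x i) ^ 2 - (1 / 2) * ∑ i, (B i - B' i) ^ 2 := by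
    simp only [Finset.mul_sum, ← Finset.sum_add_distrib, ← Finset.sum_sub_distrib]
    exact Finset.sum_congr rfl fun i _ => by ring
  have h1 := h fun i => (B i + B' i) / 2
  have h2 := h' fun i => (B i + B' i) / 2
  simp only [objective_eq] at h1 h2
  have h3 := mul_le_mul_of_nonneg_left hf hlam
  have h4 : ∑ i, (B i - B' i) ^ 2 ≤ 0 := by linarith
  have h5 := (Finset.sum_eq_zero_iff_of_nonneg fun i _ => sq_nonneg (B i - B' i)).1
    (le_antisymm h4 (Finset.sum_nonneg fun i _ => sq_nonneg _))
  ext i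
  have := h5 i (Finset.mem_univ i)
  nlinarith

/-- The slope of the fusion penalty, along the `i`-th coordinate, on decreasing vectors. -/
def slope (n : ℕ) (i : ℕ) : ℝ := (n : ℝ) - 1 - 2 * i

/-- With the signs known, `v i` appears positively for the `n - 1 - i` later indices and negatively
for the `i` earlier ones. -/
lemma fusion_of_antitone {v : Fin n → ℝ} (hv : Antitone v) :
    fusion v = ∑ i : Fin n, slope n i * v i := by
  have h1 : fusion v = ∑ i, ∑ j ∈ Finset.univ.filter (fun j => i < j), (v i - v j) := by
    refine Finset.sum_congr rfl fun i _ => Finset.sum_congr rfl fun j hj => ?_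
    have := hv (Finset.mem_filter.1 hj).2.le
    rw [abs_sub_comm, abs_of_nonneg (by linarith)]
  have h2 : ∑ i, ∑ j ∈ Finset.univ.filter (fun j => i < j), v j
      = ∑ j : Fin n, ∑ i ∈ Finset.univ.filter (fun i => i < j), v j := by
    simp only [Finset.sum_filter]
    exact Finset.sum_comm
  have h3 : ∀ i : Fin n, ((Finset.univ.filter fun j => i < j).card : ℝ) = (n : ℝ) - 1 - i := by
    intro i
    have : (Finset.univ.filter fun j => i < j) = Finset.Ioi i := by ext; simp
    have hi := i.2
    rw [this, Fin.card_Ioi, Nat.cast_sub (by omega : (i : ℕ) ≤ n - 1),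
      Nat.cast_sub (by omega : 1 ≤ n)]
    simp
  have h4 : ∀ i : Fin n, ((Finset.univ.filter fun j => j < i).card : ℝ) = i := by
    intro i
    have : (Finset.univ.filter fun j => j < i) = Finset.Iio i := by ext; simp
    rw [this, Fin.card_Iio]
  simp only [h1, Finset.sum_sub_distrib, h2, Finset.sum_const, nsmul_eq_mul, h3, h4]
  rw [← Finset.sum_sub_distrib]
  exact Finset.sum_congr rfl fun i _ => by rw [slope]; ring

/-- Expansion of the objective on decreasing vectors. -/
lemma objective_sub_of_antitone (lam : ℝ) (u : Fin n → ℝ) {v v' : Fin n → ℝ} (hv : Antitone v)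
    (hv' : Antitone v') :
    objective lam u v' - objective lam u v
      = (1 / 2) * ∑ i, (v' i - v i) ^ 2
        + ∑ i : Fin n, (v i - u i + lam * slope n i) * (v' i - v i) := by
  rw [objective_eq, objective_eq, fusion_of_antitone hv, fusion_of_antitone hv']
  simp only [Finset.mul_sum, ← Finset.sum_add_distrib, ← Finset.sum_sub_distrib]
  exact Finset.sum_congr rfl fun i _ => by ring

/-- Sorting a vector in the order of `u` does not increase the objective. -/
lemma exists_antitone_objective_le (lam : ℝ) {u : Fin n → ℝ} (hu : Antitone u) (B : Fin n → ℝ) :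
    ∃ v : Fin n → ℝ, Antitone v ∧ objective lam u v ≤ objective lam u B := by
  let τ := Tuple.sort fun i => -B i
  have hv : Antitone (B ∘ τ) := fun i j hij => by
    have := Tuple.monotone_sort (fun i => -B i) hij
    simpa [τ] using this
  refine ⟨B ∘ τ, hv, ?_⟩
  -- Rearrangement inequality. Sorting changes only the cross term of the objective, as the penalty
  -- and the sum of squares are permutation invariant.
  have h1 : ∑ i, u i * B i ≤ ∑ i, u i * (B ∘ τ) i := by
    have := (hu.monovary hv).sum_mul_comp_perm_le_sum_mul (σ := τ.symm)
    simpa using this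
  have h2 : ∑ i, ((B ∘ τ) i) ^ 2 = ∑ i, (B i) ^ 2 := Equiv.sum_comp τ fun i => (B i) ^ 2
  have h3 : ∀ f : Fin n → ℝ, ∑ i, (f i - u i) ^ 2
      = ∑ i, (f i) ^ 2 - 2 * ∑ i, u i * f i + ∑ i, (u i) ^ 2 := by
    intro f
    simp only [Finset.mul_sum, ← Finset.sum_add_distrib, ← Finset.sum_sub_distrib]
    exact Finset.sum_congr rfl fun i _ => by ring
  rw [objective_eq, objective_eq, fusion_comp_perm, h3, h3, h2]
  linarith

/-- Sufficient optimality conditions for sorted observations. -/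
lemma isSolution_of_antitone {lam : ℝ} {u v : Fin n → ℝ} (hu : Antitone u) (hv : Antitone v)
    (h0 : ∑ i : Fin n, (v i - u i + lam * slope n i) * v i = 0)
    (h : ∀ v' : Fin n → ℝ, Antitone v' →
      0 ≤ ∑ i : Fin n, (v i - u i + lam * slope n i) * v' i) :
    IsSolution lam u v := by
  intro B
  obtain ⟨v', hv', hle⟩ := exists_antitone_objective_le lam hu B
  refine le_trans ?_ hle
  have h1 := objective_sub_of_antitone lam u hv hv'
  simp only [mul_sub _ (_ : ℝ) (v _), Finset.sum_sub_distrib] at h1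
  have h2 := h v' hv'
  have h3 : 0 ≤ ∑ i, (v' i - v i) ^ 2 := Finset.sum_nonneg fun i _ => sq_nonneg _
  linarith

/-- Necessary optimality conditions: the directional derivative is nonnegative along the
directions that preserve monotonicity. -/
lemma IsSolution.directional_nonneg {lam : ℝ} {u v : Fin n → ℝ} (h : IsSolution lam u v)
    (hv : Antitone v) {d : Fin n → ℝ} (hd : ∀ i j, i ≤ j → v i = v j → d j ≤ d i) :
    0 ≤ ∑ i : Fin n, (v i - u i + lam * slope n i) * d i := by
  set s := ∑ i : Fin n, (v i - u i + lam * slope n i) * d i with hs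
  set q := ∑ i, (d i) ^ 2 with hq
  -- Strict inequalities between entries of `v` survive a small perturbation, so `d` need be
  -- decreasing only across ties.
  have hanti : ∀ᶠ ε : ℝ in nhdsWithin 0 (Set.Ioi 0), Antitone fun i => v i + ε * d i := by
    have : ∀ i j, i ≤ j → ∀ᶠ ε : ℝ in nhdsWithin 0 (Set.Ioi 0),
        v j + ε * d j ≤ v i + ε * d i := by
      intro i j hij
      rcases (hv hij).lt_or_eq with hlt | heq
      · have hc : Continuous fun ε : ℝ => v i + ε * d i - (v j + ε * d j) := by fun_prop
        have ht := (hc.tendsto 0).mono_left (nhdsWithin_le_nhds (s := Set.Ioi 0))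
        filter_upwards [ht.eventually_const_lt (u := 0) (by simpa using hlt)] with ε hε
        linarith
      · filter_upwards [self_mem_nhdsWithin] with ε hε
        have := mul_le_mul_of_nonneg_left (hd i j hij heq.symm) (le_of_lt hε)
        linarith
    simpa only [Antitone, Filter.eventually_all] using this
  have hpos : ∀ᶠ ε : ℝ in nhdsWithin 0 (Set.Ioi 0), 0 ≤ (1 / 2) * ε * q + s := by
    filter_upwards [hanti, self_mem_nhdsWithin] with ε hε hε0
    have h1 := objective_sub_of_antitone lam u hv hε
    have h2 := h fun i => v i + ε * d i
    have h3 : ∑ i, (v i + ε * d i - v i) ^ 2 = ε * (ε * q) := by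
      rw [hq]
      simp only [Finset.mul_sum]
      exact Finset.sum_congr rfl fun i _ => by ring
    have h4 : ∑ i : Fin n, (v i - u i + lam * slope n i) * (v i + ε * d i - v i) = ε * s := by
      rw [hs]
      simp only [Finset.mul_sum]
      exact Finset.sum_congr rfl fun i _ => by ring
    rw [h3, h4] at h1
    have h5 : 0 ≤ ε * ((1 / 2) * ε * q + s) := by linarith
    exact nonneg_of_mul_nonneg_right h5 hε0
  have hc : Continuous fun ε : ℝ => (1 / 2) * ε * q + s := by fun_prop
  have ht := (hc.tendsto 0).mono_left (nhdsWithin_le_nhds (s := Set.Ioi 0))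
  have := ge_of_tendsto ht hpos
  simpa using this

/-- Abel summation: nonnegative partial sums with zero total, against a decreasing sequence. -/
lemma sum_mul_nonneg_of_partial_sums {r g : ℕ → ℝ} {N : ℕ}
    (hR : ∀ l < N, 0 ≤ ∑ j ∈ Finset.range l, r j) (h0 : ∑ j ∈ Finset.range N, r j = 0)
    (hg : ∀ j, j + 1 < N → g (j + 1) ≤ g j) :
    0 ≤ ∑ j ∈ Finset.range N, r j * g j := by
  -- Retaining the boundary term of the summation by parts makes the induction close; it disappears
  -- at `m + 1 = N`, where the total is zero.
  have key : ∀ m, m + 1 ≤ N →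
      (∑ j ∈ Finset.range (m + 1), r j) * g m ≤ ∑ j ∈ Finset.range (m + 1), r j * g j := by
    intro m
    induction m with
    | zero => simp
    | succ m ih =>
      intro hm
      rw [Finset.sum_range_succ _ (m + 1), Finset.sum_range_succ _ (m + 1)]
      have h1 := ih (by omega)
      have h2 := mul_le_mul_of_nonneg_left (hg m (by omega)) (hR (m + 1) (by omega))
      linarith
  cases N with
  | zero => simp
  | succ m =>
    have := key m le_rfl
    rwa [h0, zero_mul] at this

end Clustering

/-! ### Segments, prefix sums and the polyhedral description of a clustering. -/

namespace RightLimits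

variable {n : ℕ} (t : RightLimits n)

lemma castSucc_lt_succ (k : Fin t.K) : t.t k.castSucc < t.t k.succ :=
  t.strictMono Fin.castSucc_lt_succ

lemma succ_le (k : Fin t.K) : t.t k.succ ≤ n := by
  have := t.strictMono.monotone (Fin.le_last k.succ)
  rwa [t.last] at this

lemma size_pos (k : Fin t.K) : 0 < t.size k := Nat.sub_pos_of_lt (t.castSucc_lt_succ k)

lemma castSucc_add_size (k : Fin t.K) : t.t k.castSucc + t.size k = t.t k.succ :=
  Nat.add_sub_cancel' (t.castSucc_lt_succ k).le

lemma exists_inSeg (i : Fin n) : ∃ k, t.InSeg k i := by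
  have key : ∀ m : Fin (t.K + 1), (i : ℕ) < t.t m → ∃ k, t.InSeg k i := by
    intro m
    induction m using Fin.induction with
    | zero => intro h; rw [t.zero] at h; omega
    | succ k ih =>
      intro h
      by_cases h' : (i : ℕ) < t.t k.castSucc
      · exact ih h'
      · exact ⟨k, not_lt.1 h', h⟩
  exact key (Fin.last _) (by rw [t.last]; exact i.2)

variable {t}

lemma InSeg.lt_of_lt {k k' : Fin t.K} {i i' : Fin n} (h : t.InSeg k i) (h' : t.InSeg k' i')
    (hk : k < k') : i < i' := by
  have h1 : t.t k.succ ≤ t.t k'.castSucc := t.strictMono.monotone (by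
    rw [Fin.le_def]; simpa using hk)
  have := h.2; have := h'.1
  rw [Fin.lt_def]; omega

lemma InSeg.unique {k k' : Fin t.K} {i : Fin n} (h : t.InSeg k i) (h' : t.InSeg k' i) :
    k = k' := by
  rcases lt_trichotomy k k' with hk | hk | hk
  · exact absurd (h.lt_of_lt h' hk) (lt_irrefl _)
  · exact hk
  · exact absurd (h'.lt_of_lt h hk) (lt_irrefl _)

lemma InSeg.le_of_le {k k' : Fin t.K} {i i' : Fin n} (h : t.InSeg k i) (h' : t.InSeg k' i')
    (hi : i ≤ i') : k ≤ k' := by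
  by_contra hk
  exact absurd (h'.lt_of_lt h (not_le.1 hk)) (not_lt.2 hi)

variable (t)

lemma exists_mem_seg (k : Fin t.K) :
    ∃ i : Fin n, (i : ℕ) = t.t k.castSucc ∧ t.InSeg k i :=
  ⟨⟨t.t k.castSucc, (t.castSucc_lt_succ k).trans_le (t.succ_le k)⟩, rfl, le_rfl,
    t.castSucc_lt_succ k⟩

/-- A sum over the positions, grouped by segments. -/
lemma sum_eq_sum_seg (f : Fin n → ℝ) :
    ∑ i, f i = ∑ k, ∑ i, if t.InSeg k i then f i else 0 := by
  rw [Finset.sum_comm]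
  refine Finset.sum_congr rfl fun i _ => ?_
  obtain ⟨k, hk⟩ := t.exists_inSeg i
  rw [Finset.sum_eq_single k]
  · simp [hk]
  · intro k' _ hk'
    rw [if_neg fun h => hk' (h.unique hk)]
  · simp

/-- The sum of the first `l` entries of the `k`-th segment. -/
noncomputable def prefixSum (k : Fin t.K) (l : ℕ) (f : Fin n → ℝ) : ℝ :=
  ∑ i : Fin n, if t.InSeg k i ∧ (i : ℕ) < t.t k.castSucc + l then f i else 0

lemma prefixSum_size (k : Fin t.K) (f : Fin n → ℝ) :
    t.prefixSum k (t.size k) f = ∑ i, if t.InSeg k i then f i else 0 := by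
  refine Finset.sum_congr rfl fun i _ => ?_
  rw [castSucc_add_size]
  by_cases h : t.InSeg k i
  · simp [h, h.2]
  · simp [h]

lemma prefixSum_congr (k : Fin t.K) (l : ℕ) {f g : Fin n → ℝ} (h : ∀ i, t.InSeg k i → f i = g i) :
    t.prefixSum k l f = t.prefixSum k l g := by
  refine Finset.sum_congr rfl fun i _ => ?_
  by_cases hi : t.InSeg k i
  · simp [hi, h i hi]
  · simp [hi]

lemma prefixSum_eq_sum_range (k : Fin t.K) {l : ℕ} (hl : l ≤ t.size k) (g : ℕ → ℝ) :
    t.prefixSum k l (fun i => g i) = ∑ j ∈ Finset.range l, g (t.t k.castSucc + j) := by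
  have hsz := t.castSucc_add_size k
  have hn := t.succ_le k
  refine (Fin.sum_univ_eq_sum_range (fun i => if (t.t k.castSucc ≤ i ∧ i < t.t k.succ) ∧
    i < t.t k.castSucc + l then g i else 0) n).trans ?_
  rw [← Finset.sum_filter]
  symm
  refine Finset.sum_bij (fun j _ => t.t k.castSucc + j) ?_ ?_ ?_ ?_
  · intro j hj
    simp only [Finset.mem_range] at hj
    simp only [Finset.mem_filter, Finset.mem_range]
    omega
  · intro a _ b _ h
    exact Nat.add_left_cancel h
  · intro i hi
    simp only [Finset.mem_filter, Finset.mem_range] at hi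
    exact ⟨i - t.t k.castSucc, by simp only [Finset.mem_range]; omega, by omega⟩
  · intro j _; rfl

/-- With `s` the start of the segment, the slopes `n - 1 - 2(s + j)` for `j < l` add up to `l (n -
2s - l)`. -/
lemma prefixSum_residual (lam : ℝ) (u v : Fin n → ℝ) (k : Fin t.K) {l : ℕ} (hl : l ≤ t.size k)
    {b : ℝ} (hv : ∀ i, t.InSeg k i → v i = b) :
    t.prefixSum k l (fun i => v i - u i + lam * slope n i)
      = l * b - t.prefixSum k l u + lam * (l * (n - 2 * t.t k.castSucc - l)) := by
  have h1 : t.prefixSum k l (fun i => v i - u i + lam * slope n i)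
      = t.prefixSum k l (fun i => b + lam * slope n (i : ℕ)) - t.prefixSum k l u := by
    rw [t.prefixSum_congr k l (g := fun i => (b + lam * slope n i) - u i)
      fun i hi => by rw [hv i hi]; ring]
    simp only [prefixSum, ← Finset.sum_sub_distrib]
    refine Finset.sum_congr rfl fun i _ => ?_
    split_ifs <;> simp
  have h2 : ∀ l : ℕ, ∑ j ∈ Finset.range l, (b + lam * slope n (t.t k.castSucc + j))
      = l * b + lam * (l * (n - 2 * t.t k.castSucc - l)) := by
    intro l
    induction l with
    | zero => simp
    | succ l ih => rw [Finset.sum_range_succ, ih, slope]; push_cast; ring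
  rw [h1, t.prefixSum_eq_sum_range k hl fun i => b + lam * slope n i, h2]
  ring

/-- The mean over the `k`-th segment. -/
noncomputable def segMean (k : Fin t.K) (u : Fin n → ℝ) : ℝ :=
  t.prefixSum k (t.size k) u / t.size k

lemma M_mulVec_order (u : Fin n → ℝ) (r : Fin (n - 1)) :
    (t.M *ᵥ u) (.inl r) = u ⟨r + 1, by omega⟩ - u ⟨r, by omega⟩ := by
  have h : ∀ i : Fin n, t.M (.inl r) i * u i
      = (if i = ⟨r + 1, by omega⟩ then u i else 0) - if i = ⟨r, by omega⟩ then u i else 0 := by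
    intro i
    simp only [M, Fin.ext_iff]
    by_cases h1 : (i : ℕ) = r
    · have : ¬ (i : ℕ) = r + 1 := by omega
      simp [h1]
    · by_cases h2 : (i : ℕ) = r + 1 <;> simp [h1, h2]
  simp only [mulVec, dotProduct, h, Finset.sum_sub_distrib, Finset.sum_ite_eq', Finset.mem_univ,
    if_true]

lemma left_lt_right (k : Fin (t.K - 1)) : t.left k < t.right k := by
  simp [left, right, Fin.lt_def]

lemma M_mulVec_between (u : Fin n → ℝ) (k : Fin (t.K - 1)) :
    (t.M *ᵥ u) (.inr (.inl k)) = t.segMean (t.right k) u - t.segMean (t.left k) u := by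
  simp only [segMean, prefixSum_size, Finset.sum_div, ← Finset.sum_sub_distrib, mulVec, dotProduct]
  refine Finset.sum_congr rfl fun i _ => ?_
  simp only [M]
  by_cases h1 : t.InSeg (t.left k) i
  · have h2 : ¬ t.InSeg (t.right k) i := fun h => (t.left_lt_right k).ne (h1.unique h)
    simp only [h1, h2, if_true, if_false]; ring
  · by_cases h2 : t.InSeg (t.right k) i <;> simp only [h1, h2, if_true, if_false] <;> ring

lemma M_mulVec_within (u : Fin n → ℝ) (k : Fin t.K) (l : Fin (t.size k - 1)) :
    (t.M *ᵥ u) (.inr (.inr ⟨k, l⟩))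
      = t.prefixSum k (l + 1) u / ((l : ℝ) + 1) - t.segMean k u := by
  simp only [segMean, prefixSum_size]
  simp only [prefixSum, Finset.sum_div, ← Finset.sum_sub_distrib, mulVec, dotProduct]
  refine Finset.sum_congr rfl fun i _ => ?_
  simp only [M]
  by_cases h1 : t.InSeg k i
  · by_cases h2 : (i : ℕ) < t.t k.castSucc + (l + 1) <;>
      simp only [h1, h2, true_and, if_true, if_false] <;> ring
  · simp only [h1, false_and, if_false]; ring

/-- The common value of the solution on the `k`-th segment. -/
noncomputable def segValue (lam : ℝ) (k : Fin t.K) (u : Fin n → ℝ) : ℝ :=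
  t.segMean k u - lam * (n - t.t k.castSucc - t.t k.succ)

lemma cast_succ (k : Fin t.K) : (t.t k.succ : ℝ) = t.t k.castSucc + t.size k := by
  exact_mod_cast (t.castSucc_add_size k).symm

/-- Residual partial sums, when the value on the segment is `segValue`. -/
lemma prefixSum_residual_segValue (lam : ℝ) (u v : Fin n → ℝ) (k : Fin t.K) {l : ℕ}
    (hl : l ≤ t.size k) (hl0 : 0 < l) (hv : ∀ i, t.InSeg k i → v i = t.segValue lam k u) :
    t.prefixSum k l (fun i => v i - u i + lam * slope n i)
      = l * (t.segMean k u - t.prefixSum k l u / l + lam * (t.size k - l)) := by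
  rw [t.prefixSum_residual lam u v k hl hv, segValue, cast_succ]
  have : (l : ℝ) ≠ 0 := by positivity
  field_simp
  ring

/-- Pulling the clusters back by `σ` turns them into level sets of `B ∘ σ` among positions. -/
lemma cluster_isClusteringOf_iff (B : Fin n → ℝ) (σ : Equiv.Perm (Fin n)) :
    IsClusteringOf B (t.cluster σ) ↔
      ∃ b : Fin t.K → ℝ, StrictAnti b ∧ Set.range b = Set.range B ∧
        ∀ k i, t.InSeg k i ↔ B (σ i) = b k := by
  refine exists_congr fun b => and_congr_right fun _ => and_congr_right fun _ =>
    forall_congr' fun k => ?_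
  rw [Set.ext_iff, ← σ.forall_congr_right]
  refine forall_congr' fun i => ?_
  simp [cluster]

/-- The polyhedral constraints are necessary. -/
theorem M_mulVec_le_of_isClusteringOf {lam : ℝ} {x B : Fin n → ℝ} {σ : Equiv.Perm (Fin n)}
    (hB : IsSolution lam x B) (hx : Antitone (x ∘ σ)) (hC : IsClusteringOf B (t.cluster σ)) :
    t.M *ᵥ (x ∘ σ) ≤ lam • t.m := by
  obtain ⟨b, hb, -, hmem⟩ := (t.cluster_isClusteringOf_iff B σ).1 hC
  set u := x ∘ σ with hu
  set v := B ∘ σ with hvdef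
  have hsol : IsSolution lam u v := (isSolution_comp_perm_iff lam x B σ).2 hB
  have hseg : ∀ k i, t.InSeg k i → v i = b k := fun k i h => (hmem k i).1 h
  have hv : Antitone v := by
    intro i j hij
    obtain ⟨k, hk⟩ := t.exists_inSeg i
    obtain ⟨k', hk'⟩ := t.exists_inSeg j
    rw [hseg k i hk, hseg k' j hk']
    exact hb.antitone (hk.le_of_le hk' hij)
  have hprefix : ∀ k l, 0 ≤ t.prefixSum k l (fun i => v i - u i + lam * slope n i) := by
    intro k l
    -- Raising the first `l` entries of a segment is admissible: ties of `v` occur only within a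
    -- segment, where this indicator decreases.
    have := hsol.directional_nonneg hv
      (d := fun i => if t.InSeg k i ∧ (i : ℕ) < t.t k.castSucc + l then 1 else 0) (by
        intro i j hij hvij
        by_cases hj : t.InSeg k j ∧ (j : ℕ) < t.t k.castSucc + l
        · have hi : t.InSeg k i := (hmem k i).2 (hvij.trans (hseg k j hj.1))
          rw [if_pos hj, if_pos ⟨hi, lt_of_le_of_lt hij hj.2⟩]
        · rw [if_neg hj]
          split_ifs <;> norm_num)
    simpa [prefixSum, mul_ite] using this
  have htotal : ∀ k, t.prefixSum k (t.size k) (fun i => v i - u i + lam * slope n i) ≤ 0 := by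
    intro k
    -- A whole segment may also be lowered, being a full level set; with the previous bound at `l =
    -- n_k`, the total residual is zero.
    have := hsol.directional_nonneg hv (d := fun i => if t.InSeg k i then -1 else 0) (by
        intro i j hij hvij
        have : t.InSeg k i ↔ t.InSeg k j := by
          rw [hmem, hmem]
          exact (Eq.congr_left hvij)
        simp [this])
    rw [prefixSum_size]
    have e : ∑ i : Fin n, (v i - u i + lam * slope n i) * (if t.InSeg k i then -1 else 0)
        = -∑ i : Fin n, if t.InSeg k i then v i - u i + lam * slope n i else 0 := by
      rw [← Finset.sum_neg_distrib]
      refine Finset.sum_congr rfl fun i _ => ?_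
      split_ifs <;> ring
    rw [e] at this
    linarith
  have hbk : ∀ k, b k = t.segValue lam k u := by
    intro k
    have h0 := le_antisymm (htotal k) (hprefix k (t.size k))
    rw [t.prefixSum_residual lam u v k le_rfl (hseg k)] at h0
    have hs : (0 : ℝ) < t.size k := by exact_mod_cast t.size_pos k
    rw [segValue, segMean, cast_succ]
    field_simp
    linarith
  rintro (r | k | ⟨k, l⟩)
  · rw [M_mulVec_order]
    have : u ⟨r + 1, by omega⟩ ≤ u ⟨r, by omega⟩ := hx (by simp [Fin.le_def])
    simp only [m, Pi.smul_apply, smul_eq_mul, mul_zero]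
    linarith
  -- Consecutive segments share an endpoint, which cancels when the two values are compared and
  -- leaves the span of both clusters.
  · have h1 := hb (t.left_lt_right k)
    rw [hbk, hbk, segValue, segValue] at h1
    have h2 : (t.left k).succ = (t.right k).castSucc := by simp [left, right]
    rw [M_mulVec_between]
    simp only [m, Pi.smul_apply, smul_eq_mul]
    rw [h2] at h1
    linarith
  · have hl : (l : ℕ) + 1 ≤ t.size k := by omega
    have h1 := hprefix k (l + 1)
    rw [t.prefixSum_residual_segValue lam u v k hl (by omega)
      fun i hi => (hseg k i hi).trans (hbk k)] at h1
    have h2 := nonneg_of_mul_nonneg_right h1 (by positivity)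
    push_cast at h2
    rw [M_mulVec_within]
    simp only [m, Pi.smul_apply, smul_eq_mul]
    linarith

lemma strictAnti_of_left_right {b : Fin t.K → ℝ} (h : ∀ k, b (t.right k) < b (t.left k)) :
    StrictAnti b := by
  -- `K` is generalized so that a case split can dispose of the truncated `K - 1`.
  have key : ∀ {K : ℕ} (b : Fin K → ℝ),
      (∀ k : Fin (K - 1), b ⟨k + 1, by omega⟩ < b ⟨k, by omega⟩) → StrictAnti b := by
    intro K b h
    cases K with
    | zero => exact fun i => i.elim0
    | succ K => exact Fin.strictAnti_iff_succ_lt.2 fun i => h i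
  exact key b h

/-- The polyhedral constraints are sufficient, when the separation of clusters is strict. -/
theorem isSolution_and_isClusteringOf_of_M_mulVec_le {lam : ℝ} {x : Fin n → ℝ}
    {σ : Equiv.Perm (Fin n)} (hle : t.M *ᵥ (x ∘ σ) ≤ lam • t.m)
    (hne : ∀ k, (t.M *ᵥ (x ∘ σ)) (.inr (.inl k)) ≠ (lam • t.m) (.inr (.inl k))) :
    Antitone (x ∘ σ) ∧ ∃ B, IsSolution lam x B ∧ IsClusteringOf B (t.cluster σ) := by
  set u := x ∘ σ with hu
  have hanti : Antitone u := by
    have h1 : ∀ i (hi : i + 1 < n), u ⟨i + 1, hi⟩ ≤ u ⟨i, by omega⟩ := by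
      intro i hi
      have := hle (.inl ⟨i, by omega⟩)
      rw [M_mulVec_order] at this
      simpa [m] using this
    cases n with
    | zero => exact fun i => i.elim0
    | succ n => exact Fin.antitone_iff_succ_le.2 fun i => h1 i (by omega)
  refine ⟨hanti, ?_⟩
  set b : Fin t.K → ℝ := fun k => t.segValue lam k u with hbdef
  have hb : StrictAnti b := by
    refine t.strictAnti_of_left_right fun k => ?_
    have h1 := lt_of_le_of_ne (hle (.inr (.inl k))) (hne k)
    have h2 : (t.left k).succ = (t.right k).castSucc := by simp [left, right]
    rw [M_mulVec_between] at h1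
    simp only [m, Pi.smul_apply, smul_eq_mul] at h1
    simp only [hbdef, segValue, h2]
    linarith
  choose seg hseg using t.exists_inSeg
  set v : Fin n → ℝ := fun i => b (seg i) with hvdef
  have hvb : ∀ k i, t.InSeg k i → v i = b k := fun k i h => by
    rw [hvdef]; exact congrArg b ((hseg i).unique h)
  have hv : Antitone v := fun i j hij => hb.antitone ((hseg i).le_of_le (hseg j) hij)
  have htotal : ∀ k, t.prefixSum k (t.size k) (fun i => v i - u i + lam * slope n i) = 0 := by
    intro k
    rw [t.prefixSum_residual_segValue lam u v k le_rfl (t.size_pos k) (hvb k), segMean]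
    ring
  have hprefix : ∀ k, ∀ l < t.size k,
      0 ≤ t.prefixSum k l (fun i => v i - u i + lam * slope n i) := by
    intro k l hl
    rcases Nat.eq_zero_or_pos l with rfl | hl0
    · rw [t.prefixSum_residual lam u v k (Nat.zero_le _) (hvb k)]
      have : t.prefixSum k 0 u = 0 := by
        refine Finset.sum_eq_zero fun i _ => if_neg fun h => ?_
        have := h.1.1; have := h.2
        omega
      simp [this]
    · rw [t.prefixSum_residual_segValue lam u v k hl.le hl0 (hvb k)]
      -- The row for prefix length `l` has index `l - 1`.
      have h1 := hle (.inr (.inr ⟨k, ⟨l - 1, by omega⟩⟩))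
      have h2 : ((l - 1 : ℕ) : ℝ) + 1 = l := by
        rw [Nat.cast_sub hl0]; simp
      rw [M_mulVec_within] at h1
      simp only [m, Pi.smul_apply, smul_eq_mul, h2, Nat.sub_add_cancel hl0] at h1
      exact mul_nonneg (by positivity) (by linarith)
  have hsol : IsSolution lam u v := by
    refine isSolution_of_antitone hanti hv ?_ ?_
    -- Complementary slackness: `v` is constant on each segment, where the residuals sum to zero.
    · rw [t.sum_eq_sum_seg]
      refine Finset.sum_eq_zero fun k _ => ?_
      have h1 := htotal k
      rw [prefixSum_size] at h1
      refine Eq.trans ?_ ((congrArg (b k * ·) h1).trans (mul_zero _))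
      simp only [Finset.mul_sum]
      refine Finset.sum_congr rfl fun i _ => ?_
      by_cases h : t.InSeg k i
      · rw [if_pos h, if_pos h, hvb k i h]; ring
      · simp [h]
    · intro v' hv'
      rw [t.sum_eq_sum_seg]
      refine Finset.sum_nonneg fun k _ => ?_
      rw [← prefixSum_size]
      -- Extension by zero to `ℕ`, for Abel summation; values beyond `n` are never reached inside a
      -- segment.
      set r : ℕ → ℝ := fun j =>
        if h : j < n then v ⟨j, h⟩ - u ⟨j, h⟩ + lam * slope n j else 0 with hr
      set g : ℕ → ℝ := fun j => if h : j < n then v' ⟨j, h⟩ else 0 with hg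
      have hri : ∀ i : Fin n, v i - u i + lam * slope n i = r i := fun i => by simp [hr]
      have hgi : ∀ i : Fin n, v' i = g i := fun i => by simp [hg]
      have hsz := t.castSucc_add_size k
      have hn := t.succ_le k
      simp only [hri] at htotal hprefix
      simp only [hri, hgi]
      rw [t.prefixSum_eq_sum_range k le_rfl fun j => r j * g j]
      refine sum_mul_nonneg_of_partial_sums (r := fun j => r (t.t k.castSucc + j))
        (g := fun j => g (t.t k.castSucc + j)) ?_ ?_ ?_
      · intro l hl
        rw [← t.prefixSum_eq_sum_range k hl.le r]
        exact hprefix k l hl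
      · rw [← t.prefixSum_eq_sum_range k le_rfl r]
        exact htotal k
      · intro j hj
        have h1 : t.t k.castSucc + j < n := by omega
        have h2 : t.t k.castSucc + (j + 1) < n := by omega
        simp only [hg, h1, h2, dif_pos]
        exact hv' (by simp [Fin.le_def])
  have hvσ : (v ∘ σ.symm) ∘ σ = v := by ext i; simp
  refine ⟨v ∘ σ.symm, ?_, ?_⟩
  · rw [← isSolution_comp_perm_iff lam x _ σ, hvσ]
    exact hsol
  · rw [cluster_isClusteringOf_iff]
    refine ⟨b, hb, ?_, fun k i => ?_⟩
    · rw [σ.symm.surjective.range_comp]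
      refine Set.Subset.antisymm ?_ ?_
      · rintro _ ⟨k, rfl⟩
        obtain ⟨i, -, hi⟩ := t.exists_mem_seg k
        exact ⟨i, hvb k i hi⟩
      · rintro _ ⟨i, rfl⟩
        exact ⟨seg i, rfl⟩
    · simp only [Function.comp_apply, Equiv.symm_apply_apply]
      refine ⟨hvb k i, fun h => ?_⟩
      have := hb.injective (h : b (seg i) = b k)
      exact this ▸ hseg i

variable {t}

/-- The right limits are determined by the clustering and the order. -/
lemma eq_of_isClusteringOf {t' : RightLimits n} {B : Fin n → ℝ} {σ : Equiv.Perm (Fin n)}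
    (h : IsClusteringOf B (t.cluster σ)) (h' : IsClusteringOf B (t'.cluster σ)) : t = t' := by
  obtain ⟨b, hb, hbr, hmem⟩ := (t.cluster_isClusteringOf_iff B σ).1 h
  obtain ⟨b', hb', hbr', hmem'⟩ := (t'.cluster_isClusteringOf_iff B σ).1 h'
  have hK : t.K = t'.K := by
    have h1 := Set.card_range_of_injective hb.injective
    have h2 := Set.card_range_of_injective hb'.injective
    simp only [hbr] at h1
    simp only [hbr'] at h2
    simpa using h1.symm.trans h2
  have key : ∀ (k : Fin t.K) (k' : Fin t'.K), (k : ℕ) = k' → t.t k.castSucc = t'.t k'.castSucc := by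
    have hbb : ∀ (k : Fin t.K) (k' : Fin t'.K), (k : ℕ) = k' → b k = b' k' := by
      have hc : StrictAnti fun k => b' (Fin.cast hK k) := fun i j hij => hb' hij
      -- Two strictly monotone enumerations of the same set of values agree; negation turns
      -- decreasing into increasing. Equal levels then have equal segments, hence equal starting
      -- points.
      have : (fun k => -b k) = fun k => -b' (Fin.cast hK k) := by
        refine (StrictMono.range_inj hb.neg hc.neg).1 ?_
        have e1 : (Set.range fun k => -b k) = Neg.neg '' Set.range b := Set.range_comp Neg.neg b
        have e2 : (Set.range fun k => -b' (Fin.cast hK k)) = Neg.neg '' Set.range b' := by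
          rw [← (finCongr hK).surjective.range_comp b', ← Set.range_comp]
          rfl
        rw [e1, e2, hbr, hbr']
      intro k k' hkk
      have h1 := neg_injective (congrFun this k)
      have h2 : Fin.cast hK k = k' := Fin.ext hkk
      rwa [h2] at h1
    intro k k' hkk
    have hiff : ∀ i, t.InSeg k i ↔ t'.InSeg k' i := fun i => by
      rw [hmem, hmem', hbb k k' hkk]
    obtain ⟨i, hi, hs⟩ := t.exists_mem_seg k
    obtain ⟨i', hi', hs'⟩ := t'.exists_mem_seg k'
    have h1 := ((hiff i).1 hs).1
    have h2 := ((hiff i').2 hs').1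
    omega
  obtain ⟨K, f, hf0, hfm, hfl⟩ := t
  obtain ⟨K', f', hf0', hfm', hfl'⟩ := t'
  obtain rfl : K = K' := hK
  have : f = f' := by
    ext k
    induction k using Fin.lastCases with
    | last => rw [hfl, hfl']
    | cast k => exact key k k rfl
  subst this
  rfl

/-- The order of distinct observations is unique. -/
lemma perm_eq_of_antitone {x : Fin n → ℝ} (hx : Function.Injective x) {σ τ : Equiv.Perm (Fin n)}
    (hσ : Antitone (x ∘ σ)) (hτ : Antitone (x ∘ τ)) : σ = τ := by
  have h1 : StrictMono fun i => -x (σ i) :=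
    (hσ.strictAnti_of_injective (hx.comp σ.injective)).neg
  have h2 : StrictMono fun i => -x (τ i) :=
    (hτ.strictAnti_of_injective (hx.comp τ.injective)).neg
  have h3 : (fun i => -x (σ i)) = fun i => -x (τ i) := by
    refine (StrictMono.range_inj h1 h2).1 ?_
    exact (σ.surjective.range_comp fun i => -x i).trans
      (τ.surjective.range_comp fun i => -x i).symm
  ext i : 1
  exact hx (neg_injective (congrFun h3 i))

/-- A point of the polyhedron in general position determines the clustering and the order. -/
theorem eq_of_M_mulVec_le {t' : RightLimits n} {lam : ℝ} (hlam : 0 ≤ lam) {x B : Fin n → ℝ}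
    (hx : Function.Injective x) {σ S : Equiv.Perm (Fin n)}
    (hle : t.M *ᵥ (x ∘ σ) ≤ lam • t.m)
    (hne : ∀ k, (t.M *ᵥ (x ∘ σ)) (.inr (.inl k)) ≠ (lam • t.m) (.inr (.inl k)))
    (hB : IsSolution lam x B) (hS : Antitone (x ∘ S)) (hC : IsClusteringOf B (t'.cluster S)) :
    (t', S) = (t, σ) := by
  -- The polyhedron provides some solution with clustering `(t, σ)`; uniqueness of the order, of the
  -- minimizer and of the right limits identifies it with the given one.
  obtain ⟨hanti, B', hB', hC'⟩ := t.isSolution_and_isClusteringOf_of_M_mulVec_le hle hne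
  obtain rfl := perm_eq_of_antitone hx hanti hS
  obtain rfl := hB.unique hlam hB'
  rw [eq_of_isClusteringOf hC hC']

end RightLimits


/-! ### From single tuples to the whole conditioning event. -/

/-- Gluing: if `f` has law `ν` on each of the pieces `{τ = e}`, then it has law `ν` conditionally
on their union. -/
lemma hasLaw_cond_of_pieces {Ω 𝒯 𝒳 : Type*} [MeasurableSpace Ω] [MeasurableSpace 𝒳] [Countable 𝒯]
    {P : Measure Ω} [IsFiniteMeasure P] {τ : Ω → 𝒯} {𝒢 : Set 𝒯} {f : Ω → 𝒳} {ν : Measure 𝒳}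
    (hτ : ∀ e, NullMeasurableSet {ω | τ ω = e} P)
    (hf : ∀ e ∈ 𝒢, AEMeasurable f (P.restrict {ω | τ ω = e}))
    (hlaw : ∀ e ∈ 𝒢, (P.restrict {ω | τ ω = e}).map f = P {ω | τ ω = e} • ν)
    (hpos : P {ω | τ ω ∈ 𝒢} ≠ 0) :
    HasLaw f ν P[|{ω | τ ω ∈ 𝒢}] := by
  have hU : {ω | τ ω ∈ 𝒢} = ⋃ e : 𝒢, {ω | τ ω = e} := by
    ext ω; simp
  have hd : Pairwise (Function.onFun (AEDisjoint P) fun e : 𝒢 => {ω | τ ω = e}) := by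
    intro e e' hne
    refine Disjoint.aedisjoint (Set.disjoint_left.2 fun ω h h' => hne (Subtype.ext ?_))
    exact h.symm.trans h'
  have hsum : P.restrict {ω | τ ω ∈ 𝒢} = Measure.sum fun e : 𝒢 => P.restrict {ω | τ ω = e} := by
    rw [hU, Measure.restrict_iUnion_ae hd fun e => hτ e]
  have hfm : AEMeasurable f (P.restrict {ω | τ ω ∈ 𝒢}) := by
    rw [hsum, aemeasurable_sum_measure_iff]
    exact fun e => hf e e.2
  refine ⟨hfm.smul_measure _, ?_⟩
  have hmap : (P.restrict {ω | τ ω ∈ 𝒢}).map f = P {ω | τ ω ∈ 𝒢} • ν := by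
    have hmeas : P {ω | τ ω ∈ 𝒢} = ∑' e : 𝒢, P {ω | τ ω = e} := by
      rw [hU, measure_iUnion₀ hd fun e => hτ e]
    rw [hmeas, hsum, Measure.map_sum (by rwa [← hsum])]
    ext s hs
    rw [Measure.sum_apply _ hs, Measure.smul_apply, smul_eq_mul, ← ENNReal.tsum_mul_right]
    exact tsum_congr fun e => by rw [hlaw e e.2, Measure.smul_apply, smul_eq_mul]
  rw [ProbabilityTheory.cond, Measure.map_smul, hmap, smul_smul,
    ENNReal.inv_mul_cancel hpos (measure_ne_top _ _), one_smul]

/-- Countability allows summation over the tuples and almost sure statements valid for all tuples at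
once. -/
instance {n : ℕ} : Countable (RightLimits n) := by
  refine Function.Injective.countable
    (f := fun t : RightLimits n => (⟨t.K, t.t⟩ : Σ K : ℕ, Fin (K + 1) → ℕ)) ?_
  rintro ⟨K, f, _, _, _⟩ ⟨K', f', _, _, _⟩ h
  obtain ⟨rfl, h⟩ := Sigma.mk.inj h
  obtain rfl := eq_of_heq h
  rfl

namespace Tuple

variable {n p : ℕ} (e : Tuple n p)

/-- The block structure decouples the columns, so the one-dimensional results apply to each
separately. -/
lemma bigM_mul_bigD_mulVec_vec (y : Matrix (Fin n) (Fin p) ℝ) (j : Fin p) (r : (e j).1.Row) :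
    ((e.bigM * e.bigD) *ᵥ vec y) ⟨j, r⟩ = ((e j).1.M *ᵥ ((fun i => y i j) ∘ (e j).2)) r := by
  have h : ∀ q : Fin p × Fin n, (e.bigD *ᵥ vec y) q = y ((e q.1).2 q.2) q.1 := by
    rintro ⟨j, i⟩
    have h1 := congrFun (permMatrix_mulVec (σ := (e j).2) (v := fun i => y i j)) i
    simp only [mulVec, dotProduct, Function.comp_apply] at h1
    rw [← h1, mulVec, dotProduct, Fintype.sum_prod_type, Finset.sum_eq_single j]
    · simp [bigD, vec]
    · intro j' _ hj'
      exact Finset.sum_eq_zero fun i' _ => by simp [bigD, hj'.symm]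
    · simp
  rw [← mulVec_mulVec]
  simp only [mulVec, dotProduct, bigM, of_apply, Fintype.sum_prod_type, ite_mul, zero_mul] at h ⊢
  simp only [h]
  simp

lemma mulVec_le_iff (lam : ℝ) (y : Matrix (Fin n) (Fin p) ℝ) :
    (e.bigM * e.bigD) *ᵥ vec y ≤ lam • e.bigm ↔
      ∀ j, (e j).1.M *ᵥ ((fun i => y i j) ∘ (e j).2) ≤ lam • (e j).1.m := by
  constructor
  · intro h j r
    have := h ⟨j, r⟩
    rwa [bigM_mul_bigD_mulVec_vec] at this
  · rintro h ⟨j, r⟩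
    rw [bigM_mul_bigD_mulVec_vec]
    exact h j r

/-- Equality in a separation constraint thus defines a genuine hyperplane, negligible for the law of
`vec(Y)`. -/
lemma bigM_mul_bigD_between_ne_zero (j : Fin p) (k : Fin ((e j).1.K - 1)) :
    (e.bigM * e.bigD) ⟨j, .inr (.inl k)⟩ ≠ 0 := by
  intro h
  obtain ⟨i, -, hi⟩ := (e j).1.exists_mem_seg ((e j).1.left k)
  -- Tested on data that become a unit vector after sorting, supported at a position of the left
  -- segment: the row returns `-1 / size`.
  have h1 := e.bigM_mul_bigD_mulVec_vec
    (Matrix.of fun a _ => if a = (e j).2 i then 1 else 0) j (.inr (.inl k))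
  have h2 : (fun a => (Matrix.of fun (a : Fin n) (_ : Fin p) =>
      if a = (e j).2 i then (1 : ℝ) else 0) a j) ∘ (e j).2 = Pi.single i 1 := by
    ext a; simp [Pi.single_apply]
  rw [h2, mulVec_single_one, mulVec, h, zero_dotProduct] at h1
  simp only [col_apply, RightLimits.M, hi, if_true] at h1
  have := (e j).1.size_pos ((e j).1.left k)
  have h3 : (0 : ℝ) < 1 / ((e j).1.size ((e j).1.left k) : ℝ) := by positivity
  linarith

end Tuple

end ConvClust

/-! ### The main theorem. -/

open ConvClust in
theorem mainTheorem6 {n p : ℕ} {Ω : Type*} [MeasurableSpace Ω] (P : Measure Ω)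
    [IsProbabilityMeasure P]
    -- the data: `vec(Y)` is Gaussian with mean `β` and invertible covariance matrix `Γ`
    (Y : Ω → Matrix (Fin n) (Fin p) ℝ)
    (β : Fin p × Fin n → ℝ) (Γ : Matrix (Fin p × Fin n) (Fin p × Fin n) ℝ)
    (hΓ : Γ.PosSemidef) (hΓinv : IsUnit Γ.det)
    (hY : HasLaw (fun ω => WithLp.toLp 2 (Matrix.vec (Y ω)))
      (multivariateGaussian (WithLp.toLp 2 β) Γ) P)
    -- the solutions of the `p` one-dimensional convex clustering problems
    (lam : ℝ) (hlam : 0 < lam)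
    (Bhat : Fin p → Ω → Fin n → ℝ)
    (hB : ∀ᵐ ω ∂P, ∀ j, ConvClust.IsSolution lam (fun i => Y ω i j) (Bhat j ω))
    -- the random permutations, ordering the columns decreasingly
    (S : Fin p → Ω → Equiv.Perm (Fin n))
    (hS : ∀ᵐ ω ∂P, ∀ j, Antitone fun i => Y ω (S j ω i) j)
    -- the random right limits, such that `(T, S)` yields the clustering given by `Bhat`
    (T : Fin p → Ω → ConvClust.RightLimits n)
    (hT : ∀ᵐ ω ∂P, ∀ j, ConvClust.IsClusteringOf (Bhat j ω) ((T j ω).cluster (S j ω)))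
    -- the admissible set, and the direction `κ` (its values outside `E` play no role)
    (E : Set (ConvClust.Tuple n p)) (κ : ConvClust.Tuple n p → Fin p × Fin n → ℝ)
    (hκ : ∀ e ∈ E, κ e ≠ 0)
    (hpos : 0 < P {ω | (fun j => (T j ω, S j ω)) ∈ E ∧
      κ (fun j => (T j ω, S j ω)) ⬝ᵥ β = 0}) :
    HasLaw
      (fun ω => ConvClust.Tuple.pval (fun j => (T j ω, S j ω)) lam Γ
        (κ fun j => (T j ω, S j ω)) (Y ω))
      (volume.restrict (Set.Icc (0 : ℝ) 1))
      (P[|{ω | (fun j => (T j ω, S j ω)) ∈ E ∧ κ (fun j => (T j ω, S j ω)) ⬝ᵥ β = 0}]) := by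
  have hΓp : Γ.PosDef := hΓ.posDef_iff_det_ne_zero.2 hΓinv.ne_zero
  set τ : Ω → Tuple n p := fun ω j => (T j ω, S j ω)
  set X : Ω → EuclideanSpace ℝ (Fin p × Fin n) := fun ω => WithLp.toLp 2 (vec (Y ω)) with hX
  have hhyper : ∀ (a : Fin p × Fin n → ℝ), a ≠ 0 → ∀ r : ℝ, ∀ᵐ ω ∂P, a ⬝ᵥ vec (Y ω) ≠ r := by
    intro a ha r
    have h := ae_dotProduct_ne_gaussian β hΓp ha r
    rw [← hY.map_eq] at h
    exact ae_of_ae_map hY.aemeasurable h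
  have hinj : ∀ᵐ ω ∂P, ∀ j, Function.Injective fun i => Y ω i j := by
    have : ∀ᵐ ω ∂P, ∀ j i i', i ≠ i' → Y ω i j ≠ Y ω i' j := by
      simp only [ae_all_iff]
      intro j i i' hne
      have ha : (Pi.single (j, i) 1 - Pi.single (j, i') 1 : Fin p × Fin n → ℝ) ≠ 0 := by
        intro h
        have := congrFun h (j, i)
        simp [hne] at this
      filter_upwards [hhyper _ ha 0] with ω hω h
      refine hω ?_
      simp [sub_dotProduct, vec, h]
    filter_upwards [this] with ω hω j i i' h
    by_contra hne
    exact hω j i i' hne h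
  have hgen : ∀ᵐ ω ∂P, ∀ (e : Tuple n p) (j : Fin p) (k : Fin ((e j).1.K - 1)),
      ((e.bigM * e.bigD) *ᵥ vec (Y ω)) ⟨j, .inr (.inl k)⟩
        ≠ (lam • (e j).1.m) (.inr (.inl k)) := by
    simp only [ae_all_iff]
    exact fun e j k => hhyper _ (e.bigM_mul_bigD_between_ne_zero j k) _
  -- Necessity uses only the optimality conditions; the converse needs distinct observations and
  -- strict separation, both almost sure.
  have hiff : ∀ e, ∀ᵐ ω ∂P, τ ω = e ↔ (e.bigM * e.bigD) *ᵥ (X ω).ofLp ≤ lam • e.bigm := by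
    intro e
    filter_upwards [hinj, hgen, hB, hS, hT] with ω h1 h2 h3 h4 h5
    rw [hX, Tuple.mulVec_le_iff]
    constructor
    · rintro rfl j
      exact (T j ω).M_mulVec_le_of_isClusteringOf (h3 j) (h4 j) (h5 j)
    · intro hle
      funext j
      refine RightLimits.eq_of_M_mulVec_le hlam.le (h1 j) (hle j) (fun k => ?_) (h3 j) (h4 j) (h5 j)
      rw [← Tuple.bigM_mul_bigD_mulVec_vec]
      exact h2 e j k
  have hset : ∀ e, {ω | τ ω = e} =ᵐ[P]
      X ⁻¹' {x | (e.bigM * e.bigD) *ᵥ x.ofLp ≤ lam • e.bigm} := fun e =>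
    Filter.eventuallyEq_set.2 (hiff e)
  have hpolym : ∀ e : Tuple n p, MeasurableSet
      {x : EuclideanSpace ℝ (Fin p × Fin n) | (e.bigM * e.bigD) *ᵥ x.ofLp ≤ lam • e.bigm} :=
    fun e => (WithLp.measurable_ofLp 2 _) (measurableSet_polyhedron _ _)
  -- The selections `T` and `S` are arbitrary functions of `ω`; measurability up to null sets is
  -- inherited from the polyhedron.
  have hnull : ∀ e, NullMeasurableSet {ω | τ ω = e} P := fun e =>
    (hY.aemeasurable.nullMeasurableSet_preimage (hpolym e)).congr (hset e).symm
  set f : Ω → ℝ := fun ω => (τ ω).pval lam Γ (κ (τ ω)) (Y ω) with hf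
  let g : Tuple n p → EuclideanSpace ℝ (Fin p × Fin n) → ℝ := fun e x =>
    pvalPoly Γ (κ e) (e.bigM * e.bigD) (lam • e.bigm) x.ofLp
  have hg : ∀ e, Measurable (g e) := fun e =>
    (measurable_pvalPoly _ _ _ _).comp (WithLp.measurable_ofLp 2 _)
  have hgX : ∀ e, AEMeasurable (g e ∘ X) P := fun e => (hg e).comp_aemeasurable hY.aemeasurable
  -- On a piece the random tuple and direction are constant, so the p-value is a fixed function of
  -- the data.
  have hfg : ∀ e, f =ᵐ[P.restrict {ω | τ ω = e}] g e ∘ X := by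
    intro e
    filter_upwards [ae_restrict_mem₀ (hnull e)] with ω hω
    have hω : τ ω = e := hω
    simp only [hf, hω]
    rfl
  refine hasLaw_cond_of_pieces (τ := τ) (𝒢 := {e | e ∈ E ∧ κ e ⬝ᵥ β = 0}) hnull
    (fun e _ => (hgX e).restrict.congr (hfg e).symm) (fun e he => ?_) hpos.ne'
  ext U hU
  have hinter : P ({ω | τ ω = e} ∩ g e ∘ X ⁻¹' U)
      = P (X ⁻¹' {x | (e.bigM * e.bigD) *ᵥ x.ofLp ≤ lam • e.bigm} ∩ g e ∘ X ⁻¹' U) :=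
    measure_congr (ae_eq_set_inter (hset e) (ae_eq_refl _))
  have hpiece : P {ω | τ ω = e} = P (X ⁻¹' {x | (e.bigM * e.bigD) *ᵥ x.ofLp ≤ lam • e.bigm}) :=
    measure_congr (hset e)
  rw [Measure.map_congr (hfg e), Measure.map_apply_of_aemeasurable (hgX e).restrict hU,
    Measure.restrict_apply₀' (hnull e), Set.inter_comm, hinter,
    Measure.smul_apply, smul_eq_mul, hpiece, Set.preimage_comp, ← Set.preimage_inter,
    ← Measure.map_apply_of_aemeasurable hY.aemeasurable ((hpolym e).inter (hg e hU)),
    ← Measure.map_apply_of_aemeasurable hY.aemeasurable (hpolym e), hY.map_eq]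
  exact measure_polyhedron_inter_pvalPoly β hΓp (hκ e he.1) he.2 _ _ hU
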